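/- Let $k$ be a field and let $U=\operatorname{Spec}R$, where $R$ is the henselization of the local ring of a $k$-scheme, locally of finite type, at a smooth point. Let $\pi\colon X\to U$ be a morphism of finite type, let $T\subset X$ be a closed subscheme with ideal sheaf $\mathcal I_T$ such that $\pi(T)$ does not contain the generic point of $U$, and let $b\colon\widetilde X\to X$ be the blowup of $X$ along $T$. *Ghost homotopies.* All morphisms are over $k$. For a scheme $Y$, let $\sigma_0,\sigma_1\colon Y\to\mathbb A^1_Y$ be the sections $0$ and $1$. A Nisnevich cover of $Y$ is an étale morphism $V\to Y$ such that every point of $Y$ is the image of a point of $V$ with the same residue field. A $0$-ghost homotopy of $Y$ in $X$ connecting $t_1,t_2\colon Y\to X$ is a morphism $h\colon\mathbb A^1_Y\to X$ with $h\sigma_0=t_1$ and $h\sigma_1=t_2$. For $n\ge1$, an $n$-ghost homotopy connecting $t_1,t_2$ consists of a Nisnevich cover $p\colon V\to\mathbb A^1_Y$, lifts $\widetilde\sigma_i\colon Y\to V$ of $\sigma_i$ for $i=0,1$, a Nisnevich cover $W\to V\times_{\mathbb A^1_Y}V$, a morphism $h\colon V\to X$ with $h\widetilde\sigma_i=t_{i+1}$,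 and a finite sequence $(\mathcal H_1,\dots,\mathcal H_m)$, $m\ge1$, of $(n-1)$-ghost homotopies of $W$ in $X$, each $\mathcal H_{j}$ ending where $\mathcal H_{j+1}$ starts, from $W\to V\times_{\mathbb A^1_Y}V\xrightarrow{pr_1}V\xrightarrow{h}X$ to $W\to V\times_{\mathbb A^1_Y}V\xrightarrow{pr_2}V\xrightarrow{h}X$. The total space of a $0$-ghost homotopy $\mathcal H$ is $\mathrm{Sp}(\mathcal H)=\mathbb A^1_Y$, with $f_{\mathcal H}\colon \mathbb A^1_Y\to Y$ the projection and $h_{\mathcal H}=h$; for $n\ge 1$ it is $\mathrm{Sp}(\mathcal H)=V\amalg\coprod_{j}\mathrm{Sp}(\mathcal H_j)$, with $f_{\mathcal H}\colon\mathrm{Sp}(\mathcal H)\to Y$ given by $V\to\mathbb A^1_Y\to Y$ and $\mathrm{Sp}(\mathcal H_j)\xrightarrow{f_{\mathcal H_j}}W\to Y$, and $h_{\mathcal H}\colon\mathrm{Sp}(\mathcal H)\to X$ given by $h$ and the $h_{\mathcal H_j}$. We say that $\mathcal H$ lifts to $\widetilde X$ if $h_{\mathcal H}$ factors through $b$. For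 a morphism $f\colon Z\to X$, write $f^*(\mathcal I_T)\subset\mathcal O_Z$ for the ideal sheaf generated by the image of $\mathcal I_T$. **Proposition.** Let $n\ge0$ and let $\alpha,\alpha'$ be sections of $\pi\colon X\to U$ connected by an $n$-ghost homotopy $\mathcal H$ of $U$ in $X$ that lifts to $\widetilde X$. Then there exists $r\in R$ such that 1. $r$ generates both $\alpha^*(\mathcal I_T)$ and $\alpha'^*(\mathcal I_T)$; in particular these ideals are equal; 2. $\langle r\rangle\supset I_0$ for every ideal $I_0\subset R$ such that $T$ is contained in the closed subscheme of $X$ defined by $\pi^*(I_0)$; 3. $h_{\mathcal H}^*(\mathcal I_T)$ is generated by the global section $f_{\mathcal H}^*(r)$ of $\mathcal O_{\mathrm{Sp}(\mathcal H)}$. -/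

import Mathlib

open CategoryTheory CategoryTheory.Limits AlgebraicGeometry

universe u v

noncomputable section

namespace GhostHomotopyTheory

/-! ### Henselization of a local ring -/

/-- The local `A`-algebra `R` is a henselization of the local ring `A`: it is a henselian local
ring, `A → R` is a local homomorphism inducing an isomorphism on residue fields, and `R` is a
filtered colimit of étale `A`-algebras. This characterizes the henselization
`colim_{(B, q)} B` (over étale neighbourhoods `(B, q)` of `A` with trivial residue field extension)
up to unique isomorphism of `A`-algebras. -/
structure IsHenselization (A R : Type u) [CommRing A] [IsLocalRing A] [CommRing R] [Algebra A R] :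
    Prop where
  henselian : HenselianLocalRing R
  isLocalHom : IsLocalHom (algebraMap A R)
  residue_bijective : Function.Bijective (IsLocalRing.ResidueField.map (algebraMap A R))
  indEtale : MorphismProperty.ind.{u} (RingHom.toMorphismProperty RingHom.Etale)
    (CommRingCat.ofHom (algebraMap A R))

/-! ### Ideal sheaves, effective Cartier divisors and blowups

A closed subscheme of `X` is given by its ideal sheaf, an `X.IdealSheafData`. For `g : Y ⟶ X`,
`I.comap g` is the ideal sheaf of the scheme-theoretic preimage, i.e. the ideal sheaf of `𝒪_Y`
generated by the image of `I`. -/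

/-- The ideal sheaf `I` is the ideal sheaf of an effective Cartier divisor: locally it is generated
by one nonzerodivisor. -/
def IsEffectiveCartier {X : Scheme.{u}} (I : X.IdealSheafData) : Prop :=
  ∀ x : X, ∃ W : X.affineOpens, x ∈ W.1 ∧
    ∃ f ∈ nonZeroDivisors Γ(X, W.1), I.ideal W = Ideal.span {f}

/-- `b : X' ⟶ X` is the blowup of `X` along the closed subscheme with ideal sheaf `I`: it is the
terminal object among the `X`-schemes `Y` on which the preimage of that subscheme is an
effective Cartier divisor. -/
structure IsBlowup {X X' : Scheme.{u}} (b : X' ⟶ X) (I : X.IdealSheafData) : Prop where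
  isEffectiveCartier : IsEffectiveCartier (I.comap b)
  existsUnique_lift : ∀ {Y : Scheme.{u}} (g : Y ⟶ X), IsEffectiveCartier (I.comap g) →
    ∃! l : Y ⟶ X', l ≫ b = g

/-- The ideal sheaf on `Y` generated by a global section. -/
abbrev sectionIdeal {Y : Scheme.{u}} (a : Γ(Y, ⊤)) : Y.IdealSheafData :=
  Scheme.IdealSheafData.ofIdealTop (Ideal.span {a})

/-- The pullback `f^*(r)` of `r : R` to a global section of `Y`, along `f : Y ⟶ Spec R`. -/
def pullbackSection {R : Type u} [CommRing R] {Y : Scheme.{u}} (f : Y ⟶ Spec (.of R)) (r : R) :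
    Γ(Y, ⊤) :=
  f.appTop ((Scheme.ΓSpecIso (.of R)).inv r)

/-- The ideal sheaf on `Spec R` associated with an ideal of `R`. -/
def idealSheaf {R : Type u} [CommRing R] (I : Ideal R) : (Spec (.of R)).IdealSheafData :=
  Scheme.IdealSheafData.ofIdealTop (I.map (Scheme.ΓSpecIso (.of R)).inv.hom)

/-! ### Nisnevich covers and the affine line -/

/-- A Nisnevich cover (by a single, possibly disconnected, scheme): an étale morphism such that
every point of the target has a preimage with the same residue field. -/
structure IsNisnevichCover {V Y : Scheme.{u}} (p : V ⟶ Y) : Prop where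
  etale : Etale p
  exists_point : ∀ y : Y, ∃ v : V, p v = y ∧ Function.Bijective (p.residueFieldMap v)

/-- The affine line over `U`. -/
abbrev line (U : Scheme.{u}) : Scheme.{u} := 𝔸(PUnit.{u + 1}; U)

/-- The projection of the affine line over `U` to `U`. -/
abbrev line.proj (U : Scheme.{u}) : line U ⟶ U := 𝔸(PUnit.{u + 1}; U) ↘ U

/-- The section `U ⟶ 𝔸¹_U`, `t ↦ (t, 0)`. -/
def line.zero (U : Scheme.{u}) : U ⟶ line U := AffineSpace.homOfVector (𝟙 U) fun _ ↦ 0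

/-- The section `U ⟶ 𝔸¹_U`, `t ↦ (t, 1)`. -/
def line.one (U : Scheme.{u}) : U ⟶ line U := AffineSpace.homOfVector (𝟙 U) fun _ ↦ 1

/-! ### Ghost homotopies

Everything takes place over a base scheme `S` (the spectrum of the ground field in the
application); `x : X ⟶ S` and `s : U ⟶ S` are the structure morphisms. -/

/-- A chain of `C`-links from `a` to `b`: a finite nonempty sequence `(H₁, …, H_r)` of links with
`H₁(0) = a`, `H_i(1) = H_{i+1}(0)` and `H_r(1) = b`. -/
structure Chain {T : Type v} (C : T → T → Type (v + 1)) (a b : T) : Type (v + 1) where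
  length : ℕ
  length_pos : 0 < length
  vertex : Fin (length + 1) → T
  vertex_zero : vertex 0 = a
  vertex_last : vertex (Fin.last length) = b
  link : ∀ i : Fin length, C (vertex i.castSucc) (vertex i.succ)

/-- An `𝔸¹`-homotopy of `U` in `X`, over `S`, connecting `t₁` and `t₂`. -/
structure LineHomotopy {S X : Scheme.{u}} (x : X ⟶ S) (U : Scheme.{u}) (s : U ⟶ S)
    (t₁ t₂ : U ⟶ X) : Type (u + 1) where
  h : line U ⟶ X
  h_over : h ≫ x = line.proj U ≫ s
  h_zero : line.zero U ≫ h = t₁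
  h_one : line.one U ≫ h = t₂

/-- The inductive step in the definition of ghost homotopies: the data
`(V ⟶ 𝔸¹_U, W ⟶ V ×_{𝔸¹_U} V, σ₀, σ₁, h, h^W)` where `h^W` is a chain of `C`-links. -/
structure GhostStep {S X : Scheme.{u}} (x : X ⟶ S)
    (C : ∀ (W : Scheme.{u}) (_ : W ⟶ S), (W ⟶ X) → (W ⟶ X) → Type (u + 1))
    (U : Scheme.{u}) (s : U ⟶ S) (t₁ t₂ : U ⟶ X) : Type (u + 1) where
  V : Scheme.{u}
  p : V ⟶ line U
  p_cover : IsNisnevichCover p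
  W : Scheme.{u}
  q : W ⟶ pullback p p
  q_cover : IsNisnevichCover q
  σ₀ : U ⟶ V
  σ₁ : U ⟶ V
  σ₀_p : σ₀ ≫ p = line.zero U
  σ₁_p : σ₁ ≫ p = line.one U
  h : V ⟶ X
  h_over : h ≫ x = p ≫ line.proj U ≫ s
  σ₀_h : σ₀ ≫ h = t₁
  σ₁_h : σ₁ ≫ h = t₂
  chain : Chain (C W (q ≫ pullback.fst p p ≫ p ≫ line.proj U ≫ s))
    (q ≫ pullback.fst p p ≫ h) (q ≫ pullback.snd p p ≫ h)

/-- `GhostHomotopy x n U s t₁ t₂` is the type of `n`-ghost homotopies of `U` in `X` (over `S`)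
connecting `t₁` and `t₂`. -/
def GhostHomotopy {S X : Scheme.{u}} (x : X ⟶ S) :
    ℕ → ∀ (U : Scheme.{u}) (_ : U ⟶ S), (U ⟶ X) → (U ⟶ X) → Type (u + 1)
  | 0 => LineHomotopy x
  | n + 1 => GhostStep x (GhostHomotopy x n)

/-- A scheme `space` with morphisms `toBase` to `U` and `toTarget` to `X`. -/
structure Total (U X : Scheme.{u}) : Type (u + 1) where
  space : Scheme.{u}
  toBase : space ⟶ U
  toTarget : space ⟶ X

/-- The total space `Sp(H)` of a ghost homotopy `H` of `U` in `X`, with the morphisms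
`f_H : Sp(H) ⟶ U` (`toBase`) and `h_H : Sp(H) ⟶ X` (`toTarget`). -/
def GhostHomotopy.total {S X : Scheme.{u}} {x : X ⟶ S} :
    ∀ (n : ℕ) {U : Scheme.{u}} {s : U ⟶ S} {t₁ t₂ : U ⟶ X},
      GhostHomotopy x n U s t₁ t₂ → Total U X
  | 0, U, _, _, _, (H : LineHomotopy x U _ _ _) => ⟨line U, line.proj U, H.h⟩
  | n + 1, U, _, _, _, (H : GhostStep x (GhostHomotopy x n) U _ _ _) =>
    let E : Fin H.chain.length → Total H.W X := fun i ↦ GhostHomotopy.total n (H.chain.link i)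
    { space := H.V ⨿ ∐ fun i ↦ (E i).space
      toBase := coprod.desc (H.p ≫ line.proj U) (Sigma.desc fun i ↦
        (E i).toBase ≫ H.q ≫ pullback.fst H.p H.p ≫ H.p ≫ line.proj U)
      toTarget := coprod.desc H.h (Sigma.desc fun i ↦ (E i).toTarget) }

/-- The ghost homotopy `H` lifts along `b : X' ⟶ X`: all the morphisms to `X` occurring in it lift
to `X'`, i.e. the morphism `h_H : Sp(H) ⟶ X` factors through `b`. -/
def GhostHomotopy.LiftsAlong {S X X' : Scheme.{u}} {x : X ⟶ S} {n : ℕ} {U : Scheme.{u}} {s : U ⟶ S}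
    {t₁ t₂ : U ⟶ X} (H : GhostHomotopy x n U s t₁ t₂) (b : X' ⟶ X) : Prop :=
  ∃ l : (GhostHomotopy.total n H).space ⟶ X', l ≫ b = (GhostHomotopy.total n H).toTarget

end GhostHomotopyTheory

end

noncomputable section

namespace GhostHomotopyTheory

open scoped TensorProduct Polynomial

/-! Two facts about the data drive the proof: `R` is a normal local domain, and the pullback of
`I_T` to the total space is locally principal, since it comes from the exceptional divisor of the
blowup.

Rigidity. Units of `A[X]` are constant when `A` is reduced, so a morphism from the affine line over
a reduced `Y` to a local scheme `Spec R` factors through `Y` (`line.eq_proj_zero_comp`). Hence a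
ghost homotopy, given only over the ground field, is compatible with the projection to `Spec R`
(`GhostHomotopy.comp_eq`), and every scheme occurring in it is smooth over `Spec R`.

Ideals. Let `V` be the cover of the line over `Y` in one step and `J` the pullback of `I_T` to `V`.
Localize so that `Y = Spec A` and `V` is affine. As `T` misses the generic fibre, `J` contains a
nonzero `c` of `R`, and local principality gives `L` with `J * L = (c)`. By induction on `n` the
links show that the two pullbacks of `J` to `W`, hence to the fibre square of `V`, agree. So `J` and
`L` descend to ideals of `A[X]` with product `(c)`. Since `A` is smooth over the normal ring `R`, it
is integrally closed in `A ⊗ Frac R`; Kronecker's theorem on coefficients of products then forces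
the descended ideal to be generated by constants (`ideal_polynomial_eq_map`). Thus `J` is pulled
back from `Y` (`eq_comap_section`); restricting along the lifts of 0 and 1 identifies the ideals of
the two ends.

On `Spec R` a locally principal ideal is principal, which yields `r`. -/

/-! ### Integrality and Kronecker's theorem on coefficients of products -/

/-- The values of monic polynomials at `x` form a submonoid. If it misses 0, some prime `Q` is
disjoint from it, and then `x` cannot be integral modulo `Q`. -/
theorem isIntegral_of_forall_prime_quotient {A S : Type*} [CommRing A] [CommRing S] [Algebra A S]
    {x : S} (h : ∀ Q : Ideal S, Q.IsPrime → IsIntegral A (Ideal.Quotient.mk Q x)) :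
    IsIntegral A x := by
  let M : Submonoid S :=
    { carrier := {y | ∃ p : A[X], p.Monic ∧ Polynomial.aeval x p = y}
      one_mem' := ⟨1, Polynomial.monic_one, map_one _⟩
      mul_mem' := by
        rintro _ _ ⟨p, hp, rfl⟩ ⟨q, hq, rfl⟩
        exact ⟨p * q, hp.mul hq, map_mul _ _ _⟩ }
  by_cases h0 : (0 : S) ∈ M
  · obtain ⟨p, hp, hpx⟩ := h0
    exact ⟨p, hp, hpx⟩
  · obtain ⟨Q, hQ, -, hQM⟩ := Ideal.exists_le_prime_disjoint (⊥ : Ideal S) M (by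
      rw [Set.disjoint_left]
      rintro _ rfl h
      exact h0 h)
    obtain ⟨p, hp, hpx⟩ := h Q hQ
    have hmem : Polynomial.aeval x p ∉ (M : Set S) := by
      refine Set.disjoint_left.mp hQM ?_
      have : Polynomial.aeval (Ideal.Quotient.mkₐ A Q x) p = 0 := hpx
      rw [Polynomial.aeval_algHom_apply] at this
      exact Ideal.Quotient.eq_zero_iff_mem.mp this
    exact (hmem ⟨p, hp, rfl⟩).elim

/-- Gauss's lemma for a valuation: if `a` and `b` are the first indices where the coefficients of
`F` and `G` have maximal valuation, then `F.coeff a * G.coeff b` strictly dominates the other terms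
of the coefficient `a + b` of the product, and it bounds all the products in question. -/
theorem mem_valuationSubring_of_coeff_mul {L : Type*} [Field L] (V : ValuationSubring L)
    {F G : L[X]} (h : ∀ n, (F * G).coeff n ∈ V) (i j : ℕ) : F.coeff i * G.coeff j ∈ V := by
  classical
  have key : ∀ H : L[X], H ≠ 0 → ∃ m, (∀ l, V.valuation (H.coeff l) ≤ V.valuation (H.coeff m)) ∧
      ∀ l < m, V.valuation (H.coeff l) < V.valuation (H.coeff m) := by
    intro H hH
    have hex : ∃ m, ∀ l, V.valuation (H.coeff l) ≤ V.valuation (H.coeff m) := by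
      obtain ⟨m, hm, hmax⟩ := H.support.exists_max_image (fun l ↦ V.valuation (H.coeff l))
        (Polynomial.support_nonempty.mpr hH)
      refine ⟨m, fun l ↦ ?_⟩
      by_cases hl : l ∈ H.support
      · exact hmax l hl
      · simp [Polynomial.notMem_support_iff.mp hl]
    refine ⟨Nat.find hex, Nat.find_spec hex, fun l hl ↦ ?_⟩
    have := Nat.find_min hex hl
    push Not at this
    obtain ⟨l', hl'⟩ := this
    exact hl'.trans_le (Nat.find_spec hex l')
  by_cases hF : F = 0
  · simp [hF]
  by_cases hG : G = 0
  · simp [hG]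
  obtain ⟨a, ha, ha'⟩ := key F hF
  obtain ⟨b, hb, hb'⟩ := key G hG
  have hFa : V.valuation (F.coeff a) ≠ 0 := fun h0 ↦ hF <| by
    ext l; simpa [h0] using ha l
  have hGb : V.valuation (G.coeff b) ≠ 0 := fun h0 ↦ hG <| by
    ext l; simpa [h0] using hb l
  rw [← V.valuation_le_one_iff]
  have h1 : V.valuation ((F * G).coeff (a + b)) =
      V.valuation (F.coeff a * G.coeff b) := by
    rw [Polynomial.coeff_mul, ← Finset.add_sum_erase _ _
      (show (a, b) ∈ Finset.HasAntidiagonal.antidiagonal (a + b) by simp)]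
    refine Valuation.map_add_eq_of_lt_left _ (V.valuation.map_sum_lt ?_ ?_)
    · simp [hFa, hGb]
    · rintro ⟨k, l⟩ hkl
      simp only [Finset.mem_erase, ne_eq, Prod.mk.injEq, Finset.HasAntidiagonal.mem_antidiagonal] at hkl
      simp only [map_mul]
      rcases lt_or_ge k a with hk | hk
      · exact mul_lt_mul_of_lt_of_le_of_nonneg_of_pos (ha' k hk) (hb l) zero_le (zero_lt_iff.mpr hGb)
      · have hl : l < b := by
          by_contra hl
          exact hkl.1 ⟨by omega, by omega⟩
        exact mul_lt_mul_of_le_of_lt_of_nonneg_of_pos (ha k) (hb' l hl) zero_le (zero_lt_iff.mpr hFa)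
  calc V.valuation (F.coeff i * G.coeff j)
      ≤ V.valuation (F.coeff a * G.coeff b) := by
        simp only [map_mul]; exact mul_le_mul' (ha i) (hb j)
    _ ≤ 1 := by rw [← h1, V.valuation_le_one_iff]; exact h _

/-- Kronecker: if the coefficients of a product of two polynomials are integral, then so is each
product of a coefficient of one factor with a coefficient of the other. -/
theorem isIntegral_coeff_mul_coeff {A S : Type*} [CommRing A] [CommRing S] [Algebra A S]
    {F G : S[X]} (h : ∀ n, IsIntegral A ((F * G).coeff n)) (i j : ℕ) :
    IsIntegral A (F.coeff i * G.coeff j) := by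
  refine isIntegral_of_forall_prime_quotient fun Q hQ ↦ ?_
  let L := FractionRing (S ⧸ Q)
  let φ : S →ₐ[A] L := (IsScalarTower.toAlgHom A (S ⧸ Q) L).comp (Ideal.Quotient.mkₐ A Q)
  have hinj : Function.Injective (IsScalarTower.toAlgHom A (S ⧸ Q) L) :=
    IsFractionRing.injective (S ⧸ Q) L
  refine (isIntegral_algHom_iff _ hinj).mp ?_
  change IsIntegral A (φ (F.coeff i * G.coeff j))
  let R₀ : Subring L := (integralClosure A L).toSubring
  have hcl : IsIntegrallyClosedIn R₀ L :=
    inferInstanceAs (IsIntegrallyClosedIn (integralClosure A L) L)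
  change _ ∈ R₀
  -- A subring integrally closed in a field is the intersection of the valuation subrings containing
  -- it, which reduces the claim to one valuation.
  rw [Subring.eq_iInf_of_isIntegrallyClosedIn (R := R₀)]
  simp only [Subring.mem_iInf]
  rintro ⟨V, hV⟩
  have := mem_valuationSubring_of_coeff_mul V (F := F.map φ.toRingHom) (G := G.map φ.toRingHom)
    (fun n ↦ by
      rw [← Polynomial.map_mul, Polynomial.coeff_map]
      exact hV (show _ ∈ integralClosure A L from (h n).map φ)) i j
  simpa [Polynomial.coeff_map] using this

/-! ### Ideals of a polynomial ring that divide a constant -/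

/-- Write `c` as a sum of products `p * q` with `p ∈ J` and `q ∈ L`. For `f ∈ J` the product `f * q`
is divisible by `c`, so `hdvd` makes every `f.coeff n * q` divisible by `c`. Therefore `f.coeff n *
c` lies in `c J`, and cancelling `c` puts each coefficient of `f` in `J`. -/
theorem ideal_polynomial_eq_map {A : Type*} [CommRing A] {c : A} (hc : c ∈ nonZeroDivisors A)
    (hdvd : ∀ f g : A[X], Polynomial.C c ∣ f * g → ∀ i j, c ∣ f.coeff i * g.coeff j)
    {J L : Ideal A[X]} (hJL : J * L = Ideal.span {Polynomial.C c}) :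
    ∃ J₀ : Ideal A, J = J₀.map Polynomial.C := by
  refine ⟨J.comap Polynomial.C, le_antisymm (fun f hf ↦ ?_) Ideal.map_comap_le⟩
  rw [Ideal.mem_map_C_iff]
  intro n
  rw [Ideal.mem_comap]
  have h1 : Polynomial.C c ∈ J * L := hJL ▸ Ideal.mem_span_singleton_self _
  have h2 : ∀ z ∈ J * L,
      Polynomial.C (f.coeff n) * z ∈ J * Ideal.span {Polynomial.C c} := by
    intro z hz
    induction hz using Submodule.mul_induction_on' with
    | mem_mul_mem p hp q hq =>
      rw [mul_left_comm]
      refine Ideal.mul_mem_mul hp (Ideal.mem_span_singleton.mpr ?_)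
      rw [Polynomial.C_dvd_iff_dvd_coeff]
      intro j
      rw [Polynomial.coeff_C_mul]
      exact hdvd f q (Ideal.mem_span_singleton.mp (hJL ▸ Ideal.mul_mem_mul hf hq)) n j
    | add x _ y _ hx hy => rw [mul_add]; exact add_mem hx hy
  replace h2 := h2 _ h1
  rw [Ideal.mem_mul_span_singleton] at h2
  obtain ⟨z, hz, h3⟩ := h2
  have hc' : Polynomial.C c ∈ nonZeroDivisors A[X] := by
    rw [mem_nonZeroDivisors_iff_right]
    intro g hg
    ext m
    have := congr_arg (Polynomial.coeff · m) hg
    simp only [Polynomial.coeff_mul_C, Polynomial.coeff_zero] at this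
    simpa using (mem_nonZeroDivisors_iff_right.mp hc) _ this
  rwa [← (mul_cancel_right_mem_nonZeroDivisors hc').mp h3]

/-- Integral closure commutes with smooth base change, so normality of `R` makes `A` integrally
closed in `A ⊗ Frac R`; this is applied to `a / c`. -/
theorem dvd_of_isIntegral_of_smooth {R : Type u} {A : Type u} [CommRing R] [IsDomain R]
    [IsIntegrallyClosed R] [CommRing A] [Algebra R A] [Algebra.Smooth R A]
    {c : R} (hc : c ≠ 0) {a : A}
    (h : IsIntegral A (a ⊗ₜ[R] (algebraMap R (FractionRing R) c)⁻¹)) : algebraMap R A c ∣ a := by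
  let K := FractionRing R
  have hcK : algebraMap R K c ≠ 0 := by simpa using hc
  obtain ⟨y, hy⟩ := (TensorProduct.toIntegralClosure_bijective_of_smooth (R := R) (S := A)
    (B := K)).2 ⟨_, h⟩
  have hy' : ∃ a' : A, a' ⊗ₜ[R] (1 : K) = a ⊗ₜ[R] (algebraMap R K c)⁻¹ := by
    have : ∀ y, ∃ a' : A, a' ⊗ₜ[R] (1 : K) =
        (TensorProduct.toIntegralClosure R A K y : A ⊗[R] K) := by
      intro y
      induction y using TensorProduct.induction_on with
      | zero => exact ⟨0, by simp⟩
      | add x y hx hy =>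
        obtain ⟨p, hp⟩ := hx
        obtain ⟨q, hq⟩ := hy
        exact ⟨p + q, by simp [TensorProduct.add_tmul, hp, hq]⟩
      | tmul p q =>
        obtain ⟨r, hr⟩ := IsIntegrallyClosed.isIntegral_iff.mp q.2
        refine ⟨r • p, ?_⟩
        rw [TensorProduct.smul_tmul, ← Algebra.algebraMap_eq_smul_one, hr]
        simp [TensorProduct.toIntegralClosure]
    obtain ⟨a', ha'⟩ := this y
    exact ⟨a', by rw [ha', hy]⟩
  obtain ⟨a', ha'⟩ := hy'
  have hinj : Function.Injective fun x : A ↦ x ⊗ₜ[R] (1 : K) :=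
    Algebra.TensorProduct.includeLeft_injective (S := R) (IsFractionRing.injective R K)
  refine ⟨a', hinj ?_⟩
  have := congr_arg (c • ·) ha'
  rw [TensorProduct.smul_tmul', ← TensorProduct.tmul_smul, Algebra.smul_def c a',
    Algebra.smul_def c (_ : K), mul_inv_cancel₀ hcK] at this
  exact this.symm

/-- Kronecker's theorem is applied over `A ⊗ Frac R` to `f` and `g / c`, whose product has
coefficients in `A`. -/
theorem coeff_dvd_of_smooth {R : Type u} {A : Type u} [CommRing R] [IsDomain R]
    [IsIntegrallyClosed R] [CommRing A] [Algebra R A] [Algebra.Smooth R A]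
    {c : R} (hc : c ≠ 0) (f g : A[X]) (h : Polynomial.C (algebraMap R A c) ∣ f * g) (i j : ℕ) :
    algebraMap R A c ∣ f.coeff i * g.coeff j := by
  let K := FractionRing R
  let ι : A →+* A ⊗[R] K := Algebra.TensorProduct.includeLeftRingHom
  refine dvd_of_isIntegral_of_smooth hc ?_
  obtain ⟨q, hq⟩ := h
  have key := isIntegral_coeff_mul_coeff (A := A) (F := f.map ι)
    (G := g.map ι * Polynomial.C (1 ⊗ₜ (algebraMap R K c)⁻¹)) (fun n ↦ by
      rw [← mul_assoc, Polynomial.coeff_mul_C, ← Polynomial.map_mul, Polynomial.coeff_map, hq,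
        Polynomial.coeff_C_mul]
      have : ι (algebraMap R A c * q.coeff n) * 1 ⊗ₜ (algebraMap R K c)⁻¹ =
          algebraMap A (A ⊗[R] K) (q.coeff n) := by
        simp only [ι, Algebra.TensorProduct.includeLeftRingHom_apply,
          Algebra.TensorProduct.tmul_mul_tmul, one_mul, mul_one]
        rw [← Algebra.smul_def, TensorProduct.smul_tmul, Algebra.smul_def c (_ : K),
          mul_inv_cancel₀ (by simpa using hc)]
        rfl
      rw [this]
      exact isIntegral_algebraMap) i j
  simpa [ι, Polynomial.coeff_mul_C] using key

/-- Descent of ideals along a flat ring map. -/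
theorem map_comap_eq_of_flat {A B : Type*} [CommRing A] [CommRing B] [Algebra A B]
    [Module.Flat A B] (J : Ideal B)
    (h : J.map (Algebra.TensorProduct.includeLeft : B →ₐ[A] B ⊗[A] B) ≤
      J.map (Algebra.TensorProduct.includeRight : B →ₐ[A] B ⊗[A] B)) :
    (J.comap (algebraMap A B)).map (algebraMap A B) = J := by
  refine le_antisymm Ideal.map_comap_le fun b hb ↦ ?_
  let I := J.comap (algebraMap A B)
  let φ : (A ⧸ I) →ₐ[A] (B ⧸ J) := Ideal.quotientMapₐ J (Algebra.ofId A B) le_rfl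
  have hφ : Function.Injective φ := Ideal.quotientMap_injective
  have hφ' : Function.Injective (φ.toLinearMap.lTensor B) :=
    Module.Flat.lTensor_preserves_injective_linearMap _ hφ
  -- The hypothesis kills `b ⊗ 1` in `B ⊗ B/J`. By flatness `B ⊗ A/I` embeds there, so `b` already
  -- vanishes in `B/IB`.
  have h1 : b ⊗ₜ[A] (1 : B ⧸ J) = 0 := by
    let ψ : B ⊗[A] B →ₐ[A] B ⊗[A] (B ⧸ J) :=
      Algebra.TensorProduct.map (AlgHom.id A B) (Ideal.Quotient.mkₐ A J)
    have h2 : J.map (Algebra.TensorProduct.includeRight : B →ₐ[A] B ⊗[A] B) ≤ RingHom.ker ψ := by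
      rw [Ideal.map_le_iff_le_comap]
      intro x hx
      simp [ψ, RingHom.mem_ker, Ideal.Quotient.eq_zero_iff_mem.mpr hx]
    have h3 := h2 (h (Ideal.mem_map_of_mem _ hb))
    simpa [ψ, RingHom.mem_ker] using h3
  have h4 : b ⊗ₜ[A] (1 : A ⧸ I) = 0 := hφ' (by simpa using h1)
  have h5 := congr_arg (TensorProduct.tensorQuotEquivQuotSMul B I) h4
  have h6 : (TensorProduct.tensorQuotEquivQuotSMul B I) (b ⊗ₜ[A] (1 : A ⧸ I)) =
      Submodule.Quotient.mk b := by
    have := TensorProduct.tensorQuotEquivQuotSMul_tmul_mk (M := B) I b 1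
    rwa [one_smul] at this
  rw [h6, map_zero, Submodule.Quotient.mk_eq_zero] at h5
  rw [Ideal.smul_top_eq_map] at h5
  exact h5

theorem algebraMap_mem_nonZeroDivisors_of_flat {A B : Type*} [CommRing A] [CommRing B] [Algebra A B]
    [Module.Flat A B] {c : A} (hc : c ∈ nonZeroDivisors A) :
    algebraMap A B c ∈ nonZeroDivisors B := by
  have h1 : IsSMulRegular A c := fun x y hxy ↦ (mul_cancel_left_mem_nonZeroDivisors hc).mp hxy
  have h2 : IsSMulRegular B (algebraMap A B c) := h1.of_flat
  rw [mem_nonZeroDivisors_iff_left]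
  intro x hx
  exact h2 (by simpa using hx)

theorem span_singleton_mul_cancel {B : Type*} [CommRing B] {z : B} (hz : z ∈ nonZeroDivisors B)
    {I J : Ideal B} (h : Ideal.span {z} * I = Ideal.span {z} * J) : I = J := by
  rw [Ideal.span_singleton_mul_eq_span_singleton_mul] at h
  refine le_antisymm (fun x hx ↦ ?_) (fun x hx ↦ ?_)
  · obtain ⟨y, hy, e⟩ := h.1 x hx
    rwa [(mul_cancel_left_mem_nonZeroDivisors hz).mp e]
  · obtain ⟨y, hy, e⟩ := h.2 x hx
    rwa [← (mul_cancel_left_mem_nonZeroDivisors hz).mp e]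

/-- The cofactor `L` inherits the descent condition from `J`: with indices for the two pullbacks, `z
L₁ = J₁ L₂ L₁ = z L₂`, and `z` is a nonzerodivisor. Hence both ideals descend, and faithful flatness
descends the equation `J * L = (c)` too. -/
theorem exists_map_algebraMap_eq_of_descent {R A : Type u} {B : Type u} [CommRing R] [IsDomain R]
    [IsIntegrallyClosed R] [CommRing A] [Algebra R A] [Algebra.Smooth R A]
    [CommRing B] [Algebra A[X] B] [Module.FaithfullyFlat A[X] B]
    {c : R} (hc : c ≠ 0) {J L : Ideal B}
    (hJL : J * L = Ideal.span {algebraMap A[X] B (Polynomial.C (algebraMap R A c))})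
    (h : J.map (Algebra.TensorProduct.includeLeft : B →ₐ[A[X]] B ⊗[A[X]] B) =
      J.map (Algebra.TensorProduct.includeRight : B →ₐ[A[X]] B ⊗[A[X]] B)) :
    ∃ J₀ : Ideal A, J = (J₀.map Polynomial.C).map (algebraMap A[X] B) := by
  have hcA : algebraMap R A c ∈ nonZeroDivisors A :=
    algebraMap_mem_nonZeroDivisors_of_flat (by simpa using hc)
  have hcAX : Polynomial.C (algebraMap R A c) ∈ nonZeroDivisors A[X] :=
    algebraMap_mem_nonZeroDivisors_of_flat (A := A) (B := A[X]) hcA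
  set z := Polynomial.C (algebraMap R A c)
  have hz : algebraMap A[X] (B ⊗[A[X]] B) z ∈ nonZeroDivisors (B ⊗[A[X]] B) :=
    algebraMap_mem_nonZeroDivisors_of_flat hcAX
  have hL : L.map (Algebra.TensorProduct.includeLeft : B →ₐ[A[X]] B ⊗[A[X]] B) =
      L.map (Algebra.TensorProduct.includeRight : B →ₐ[A[X]] B ⊗[A[X]] B) := by
    have h1 := congr_arg
      (Ideal.map (Algebra.TensorProduct.includeLeft : B →ₐ[A[X]] B ⊗[A[X]] B)) hJL
    have h2 := congr_arg
      (Ideal.map (Algebra.TensorProduct.includeRight : B →ₐ[A[X]] B ⊗[A[X]] B)) hJL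
    rw [Ideal.map_mul, Ideal.map_span, Set.image_singleton, AlgHom.commutes] at h1 h2
    rw [← h] at h2
    have h3 : Ideal.span {algebraMap A[X] (B ⊗[A[X]] B) z} * L.map
        (Algebra.TensorProduct.includeLeft : B →ₐ[A[X]] B ⊗[A[X]] B) =
        Ideal.span {algebraMap A[X] (B ⊗[A[X]] B) z} * L.map
        (Algebra.TensorProduct.includeRight : B →ₐ[A[X]] B ⊗[A[X]] B) := by
      nth_rw 1 [← h2]
      rw [← h1]
      ring
    exact span_singleton_mul_cancel hz h3
  have hJ' := map_comap_eq_of_flat J h.le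
  have hL' := map_comap_eq_of_flat L hL.le
  set J' := J.comap (algebraMap A[X] B)
  set L' := L.comap (algebraMap A[X] B)
  have hJL' : J' * L' = Ideal.span {z} := by
    have : (J' * L').map (algebraMap A[X] B) = (Ideal.span {z}).map (algebraMap A[X] B) := by
      rw [Ideal.map_mul, hJ', hL', hJL, Ideal.map_span, Set.image_singleton]
    rw [← Ideal.comap_map_eq_self_of_faithfullyFlat (B := B) (J' * L'), this,
      Ideal.comap_map_eq_self_of_faithfullyFlat]
  obtain ⟨J₀, h0⟩ := ideal_polynomial_eq_map hcA (coeff_dvd_of_smooth hc) hJL'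
  exact ⟨J₀, by rw [← h0, hJ']⟩

/-- The cofactor is `(c) : J`. Near a maximal ideal, if `s J ⊆ (f)` and `s c = f g`, then `s g` lies
in it and `f * (s g) = s² c`. The generator `f` need not be a nonzerodivisor. -/
theorem exists_mul_eq_span_of_locally_principal {B : Type*} [CommRing B] {J : Ideal B} {c : B}
    (hc : c ∈ J) (h : ∀ P : Ideal B, P.IsPrime → ∃ s ∉ P, ∃ f ∈ J, ∀ j ∈ J, f ∣ s * j) :
    ∃ L : Ideal B, J * L = Ideal.span {c} := by
  let L : Ideal B := (Ideal.span {c}).colon (J : Set B)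
  refine ⟨L, le_antisymm ?_ ?_⟩
  · rw [Ideal.mul_le]
    intro r hr s hs
    rw [mul_comm]
    exact Submodule.mem_colon.mp hs r hr
  · rw [Ideal.span_singleton_le_iff_mem]
    suffices (J * L).colon {c} = ⊤ by
      have := (Ideal.eq_top_iff_one _).mp this
      simpa using Submodule.mem_colon_singleton.mp this
    by_contra hne
    obtain ⟨m, hm, hle⟩ := Ideal.exists_le_maximal _ hne
    obtain ⟨s, hs, f, hf, hdvd⟩ := h m hm.isPrime
    obtain ⟨g, hg⟩ := hdvd c hc
    have hsg : s * g ∈ L := by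
      refine Submodule.mem_colon.mpr fun j hj ↦ ?_
      obtain ⟨h', hh'⟩ := hdvd j hj
      refine Ideal.mem_span_singleton.mpr ⟨s * h', ?_⟩
      calc s * g * j = g * (s * j) := by ring
        _ = (f * g) * h' := by rw [hh']; ring
        _ = c * (s * h') := by rw [← hg]; ring
    have : s * s ∈ m := hle <| Submodule.mem_colon_singleton.mpr <| by
      have := Ideal.mul_mem_mul hf hsg
      convert this using 1
      calc s * s * c = s * (s * c) := by ring
        _ = f * (s * g) := by rw [hg]; ring
    exact hs ((hm.isPrime.mem_or_mem this).elim id id)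

/-! ### Normality of local rings at smooth points and of their henselizations -/

/-- `S` is torsion-free over the domain `P`, integrally closed in `S ⊗ Frac P`, and `S ⊗ Frac P` is
von Neumann regular; each condition is stated with denominators cleared. -/
structure GenericallyRegular (P S : Type*) [CommRing P] [CommRing S] [Algebra P S] : Prop where
  nonZeroDivisor : ∀ p : P, p ≠ 0 → algebraMap P S p ∈ nonZeroDivisors S
  dvd_of_integral : ∀ (p : P), p ≠ 0 → ∀ (a : S) (f : S[X]), f.Monic →
    (f.scaleRoots (algebraMap P S p)).eval a = 0 → algebraMap P S p ∣ a
  regular : ∀ a : S, ∃ p : P, p ≠ 0 ∧ ∃ b : S, algebraMap P S p * a = a * a * b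

namespace GenericallyRegular

variable {P S : Type*} [CommRing P] [CommRing S] [Algebra P S]

/-- From `p a = a² b` the fraction `e = a b / p` is idempotent. It is a root of `X² - X`, hence
integral and in `S`; as `S` is local, `e` is 0 or 1, and `e = 0` would force `a = 0`. -/
theorem exists_mul_eq_of_ne_zero [IsDomain P] [IsLocalRing S] (h : GenericallyRegular P S) {a : S}
    (ha : a ≠ 0) : ∃ p : P, p ≠ 0 ∧ ∃ b : S, a * b = algebraMap P S p := by
  obtain ⟨p, hp, b, hb⟩ := h.regular a
  have hpS := h.nonZeroDivisor p hp
  obtain ⟨e, he⟩ : algebraMap P S p ∣ a * b := by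
    refine h.dvd_of_integral p hp _ (Polynomial.X ^ 2 - Polynomial.X)
      (by monicity!) ?_
    have hd : (Polynomial.X ^ 2 - Polynomial.X : S[X]).natDegree = 2 := by compute_degree!
    rw [Polynomial.eval_eq_sum_range, Polynomial.natDegree_scaleRoots, hd]
    simp only [Finset.sum_range_succ, Finset.sum_range_zero, Polynomial.coeff_scaleRoots, hd]
    simp [Polynomial.coeff_X, Polynomial.coeff_X_pow]
    linear_combination (-b) * hb
  have hee : e * (1 - e) = 0 := by
    refine (mul_left_mem_nonZeroDivisors_eq_zero_iff hpS).mp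
      ((mul_left_mem_nonZeroDivisors_eq_zero_iff hpS).mp ?_)
    linear_combination b * hb + (a * b + algebraMap P S p * e - algebraMap P S p) * he
  rcases IsLocalRing.isUnit_or_isUnit_one_sub_self e with h1 | h1
  · have : e = 1 := by
      have := h1.mul_right_eq_zero.mp hee
      exact (sub_eq_zero.mp this).symm
    exact ⟨p, hp, b, by rw [he, this, mul_one]⟩
  · have : e = 0 := h1.mul_left_eq_zero.mp hee
    rw [this, mul_zero] at he
    refine (ha ?_).elim
    rw [mul_assoc, he, mul_zero] at hb
    exact (mul_right_mem_nonZeroDivisors_eq_zero_iff hpS).mp (by rwa [mul_comm])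

theorem isDomain [IsDomain P] [IsLocalRing S] (h : GenericallyRegular P S) : IsDomain S := by
  have : NoZeroDivisors S := ⟨fun {a b} hab ↦ by
    by_contra! hne
    obtain ⟨p, hp, c, hc⟩ := h.exists_mul_eq_of_ne_zero hne.1
    have hpS := h.nonZeroDivisor p hp
    refine hne.2 ((mul_left_mem_nonZeroDivisors_eq_zero_iff hpS).mp ?_)
    rw [← hc, mul_right_comm, hab, zero_mul]⟩
  exact NoZeroDivisors.to_isDomain S

/-- Any denominator `a` divides a nonzero constant `p` of `P`, so every fraction has a constant
denominator and `dvd_of_integral` applies. -/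
theorem isIntegrallyClosed [IsDomain P] [IsLocalRing S] (h : GenericallyRegular P S) :
    IsIntegrallyClosed S := by
  have := h.isDomain
  rw [isIntegrallyClosed_iff (FractionRing S)]
  intro x hx
  obtain ⟨s, a, ha, rfl⟩ := IsFractionRing.div_surjective (A := S) x
  obtain ⟨p, hp, b, hb⟩ := h.exists_mul_eq_of_ne_zero (nonZeroDivisors.ne_zero ha)
  have hpS := nonZeroDivisors.ne_zero (h.nonZeroDivisor p hp)
  have hb0 : b ≠ 0 := by rintro rfl; exact hpS (by rw [← hb, mul_zero])
  obtain ⟨f, hf, hfx⟩ := hx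
  obtain ⟨y, hy⟩ : algebraMap P S p ∣ s * b := by
    refine h.dvd_of_integral p hp _ f hf ?_
    have hdiv : algebraMap S (FractionRing S) s / algebraMap S (FractionRing S) a =
        algebraMap S (FractionRing S) (s * b) /
          algebraMap S (FractionRing S) (algebraMap P S p) := by
      rw [← hb, map_mul, map_mul, mul_div_mul_right]
      simpa using hb0
    have := Polynomial.scaleRoots_aeval_eq_zero_of_aeval_div_eq_zero
      (IsFractionRing.injective S (FractionRing S)) (p := f) (r := s * b) (s := algebraMap P S p)
      (by rw [← hdiv]; exact hfx) (h.nonZeroDivisor p hp)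
    rw [Polynomial.aeval_algebraMap_apply] at this
    exact IsFractionRing.injective S (FractionRing S) (by simpa using this)
  refine ⟨y, ?_⟩
  have ha0 : algebraMap S (FractionRing S) a ≠ 0 := by
    simpa using nonZeroDivisors.ne_zero ha
  rw [eq_div_iff ha0, ← map_mul]
  congr 1
  refine mul_right_cancel₀ hb0 ?_
  rw [hy, mul_assoc, hb, mul_comm]

end GenericallyRegular

theorem exists_tmul_inv_eq {P S : Type*} [CommRing P] [IsDomain P] [CommRing S] [Algebra P S]
    (y : S ⊗[P] FractionRing P) :
    ∃ (b : S) (p : P), p ≠ 0 ∧ y = b ⊗ₜ[P] (algebraMap P (FractionRing P) p)⁻¹ := by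
  induction y using TensorProduct.induction_on with
  | zero => exact ⟨0, 1, one_ne_zero, by simp⟩
  | tmul s k =>
    obtain ⟨r, q, hq, rfl⟩ := IsFractionRing.div_surjective (A := P) k
    refine ⟨r • s, q, nonZeroDivisors.ne_zero hq, ?_⟩
    rw [TensorProduct.smul_tmul, Algebra.smul_def, div_eq_mul_inv]
  | add x y hx hy =>
    obtain ⟨b, p, hp, rfl⟩ := hx
    obtain ⟨b', p', hp', rfl⟩ := hy
    refine ⟨p' • b + p • b', p * p', mul_ne_zero hp hp', ?_⟩
    have h1 : algebraMap P (FractionRing P) p ≠ 0 := by simpa using hp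
    have h2 : algebraMap P (FractionRing P) p' ≠ 0 := by simpa using hp'
    rw [TensorProduct.add_tmul, TensorProduct.smul_tmul, TensorProduct.smul_tmul,
      Algebra.smul_def, Algebra.smul_def, map_mul]
    congr 2
    · field_simp
    · field_simp

namespace GenericallyRegular

/-- An étale algebra over `Frac P` is a finite product of fields, hence von Neumann regular;
denominators are then cleared. The other two conditions come from flatness and smooth base change.
-/
theorem of_etale {P S : Type u} [CommRing P] [IsDomain P] [IsIntegrallyClosed P] [CommRing S]
    [Algebra P S] [Algebra.Etale P S] : GenericallyRegular P S where
  nonZeroDivisor p hp := algebraMap_mem_nonZeroDivisors_of_flat (by simpa using hp)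
  dvd_of_integral p hp a f hf hfa := by
    refine dvd_of_isIntegral_of_smooth hp ⟨f, hf, ?_⟩
    let K := FractionRing P
    have hpK : algebraMap P K p ≠ 0 := by simpa using hp
    have hu : IsUnit (algebraMap S (S ⊗[P] K) (algebraMap P S p)) := by
      have : algebraMap S (S ⊗[P] K) (algebraMap P S p) = 
          Algebra.TensorProduct.includeRight (algebraMap P K p) := by
        rw [AlgHom.commutes, ← IsScalarTower.algebraMap_apply]
      rw [this]
      exact (IsUnit.mk0 _ hpK).map _
    refine (hu.pow f.natDegree).mul_right_eq_zero.mp ?_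
    rw [← Polynomial.scaleRoots_eval₂_mul]
    have h1 : algebraMap S (S ⊗[P] K) (algebraMap P S p) * a ⊗ₜ (algebraMap P K p)⁻¹ =
        algebraMap S (S ⊗[P] K) a := by
      rw [← IsScalarTower.algebraMap_apply, ← Algebra.smul_def, ← TensorProduct.tmul_smul,
        Algebra.smul_def, mul_inv_cancel₀ hpK]
      rfl
    rw [h1, Polynomial.eval₂_at_apply, hfa, map_zero]
  regular a := by
    let K := FractionRing P
    have hreg : ∀ x : K ⊗[P] S, ∃ y, x = x * x * y := by
      obtain ⟨I, _, Ai, _, _, e, -⟩ :=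
        (Algebra.Etale.iff_exists_algEquiv_prod K (K ⊗[P] S)).mp inferInstance
      intro x
      -- The componentwise inverse, with the convention that the inverse of 0 is 0, is a
      -- quasi-inverse.
      refine ⟨e.symm fun i ↦ (e x i)⁻¹, e.injective ?_⟩
      ext i
      simp only [map_mul, AlgEquiv.apply_symm_apply, Pi.mul_apply]
      by_cases h : e x i = 0
      · simp [h]
      · field_simp
    obtain ⟨y, hy⟩ := hreg (1 ⊗ₜ a)
    obtain ⟨b, p, hp, hb⟩ := exists_tmul_inv_eq (Algebra.TensorProduct.comm P K S y)
    refine ⟨p, hp, b, ?_⟩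
    have hpK : algebraMap P K p ≠ 0 := by simpa using hp
    have h1 := congr_arg (Algebra.TensorProduct.comm P K S) hy
    simp only [map_mul, hb, Algebra.TensorProduct.comm_tmul,
      Algebra.TensorProduct.tmul_mul_tmul, mul_one, one_mul] at h1
    have h2 := congr_arg (p • ·) h1
    have hinj : Function.Injective fun x : S ↦ x ⊗ₜ[P] (1 : K) :=
      Algebra.TensorProduct.includeLeft_injective (S := P) (IsFractionRing.injective P K)
    refine hinj ?_
    beta_reduce at h2 ⊢
    rw [TensorProduct.smul_tmul', ← TensorProduct.tmul_smul, Algebra.smul_def, Algebra.smul_def,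
      mul_inv_cancel₀ hpK] at h2
    exact h2

theorem of_isLocalization {P S T : Type*} [CommRing P] [CommRing S] [Algebra P S]
    [CommRing T] [Algebra P T] [Algebra S T] [IsScalarTower P S T] (M : Submonoid S)
    [IsLocalization M T] (h : GenericallyRegular P S) : GenericallyRegular P T where
  nonZeroDivisor p hp := by
    have : Module.Flat S T := IsLocalization.flat T M
    rw [IsScalarTower.algebraMap_apply P S T]
    exact algebraMap_mem_nonZeroDivisors_of_flat (h.nonZeroDivisor p hp)
  dvd_of_integral p hp a f hf hfa := by
    nontriviality T
    obtain ⟨g, hg, hgd, hgm⟩ := Polynomial.lifts_and_natDegree_eq_and_monic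
      (IsLocalization.scaleRoots_commonDenom_mem_lifts M f
        (by rw [hf.leadingCoeff]; exact one_mem _)) (by rwa [Polynomial.monic_scaleRoots_iff])
    rw [Polynomial.natDegree_scaleRoots] at hgd
    set d := IsLocalization.commonDenom M f.support f.coeff
    obtain ⟨⟨s, m⟩, hs⟩ := IsLocalization.surj M a
    simp only at hs
    have hmap : ∀ (q : S[X]) (r : S), q.Monic →
        (q.scaleRoots r).map (algebraMap S T) = (q.map (algebraMap S T)).scaleRoots
          (algebraMap S T r) := fun q r hq ↦
      Polynomial.map_scaleRoots _ _ _ (by rw [hq.leadingCoeff, map_one]; exact one_ne_zero)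
    have h1 : algebraMap S T
        (((g.scaleRoots (algebraMap P S p)).scaleRoots m).eval (d * s)) = 0 := by
      have hds : algebraMap S T (d * s) = algebraMap S T m * (algebraMap S T d * a) := by
        rw [map_mul, ← hs]; ring
      rw [← Polynomial.eval_map_apply, hds, hmap _ _ (by rwa [Polynomial.monic_scaleRoots_iff]),
        Polynomial.scaleRoots_eval_mul, hmap _ _ hgm, hg, ← Polynomial.scaleRoots_mul, mul_comm
        (algebraMap S T _) (algebraMap S T (algebraMap P S p)), Polynomial.scaleRoots_mul,
        Polynomial.scaleRoots_eval_mul, ← IsScalarTower.algebraMap_apply, hfa, mul_zero, mul_zero]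
    obtain ⟨m', hm'⟩ := (IsLocalization.map_eq_zero_iff M T _).mp h1
    -- Scaling roots by `m'` multiplies the value at a point scaled by `m'` by `m' ^ natDegree`, so
    -- positive degree is needed for a factor `m'` to appear and annihilate it.
    have hdeg : g.natDegree ≠ 0 := by
      intro h0
      have hf1 : f = 1 := hf.natDegree_eq_zero.mp (hgd ▸ h0)
      rw [hf1, Polynomial.one_scaleRoots, Polynomial.eval_one] at hfa
      exact one_ne_zero hfa
    obtain ⟨y, hy⟩ := h.dvd_of_integral p hp (m' * (d * s)) (g.scaleRoots (m * m'))
      (by rwa [Polynomial.monic_scaleRoots_iff]) (by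
        rw [← Polynomial.scaleRoots_mul, mul_comm (_ * _ : S) (algebraMap P S p),
          Polynomial.scaleRoots_mul, Polynomial.scaleRoots_mul, Polynomial.scaleRoots_eval_mul]
        simp only [Polynomial.natDegree_scaleRoots]
        obtain ⟨n, hn⟩ := Nat.exists_eq_succ_of_ne_zero hdeg
        rw [hn, pow_succ, mul_assoc, hm', mul_zero])
    have hu : IsUnit (algebraMap S T (m' * d * m : S)) := by
      exact_mod_cast IsLocalization.map_units T (m' * d * m)
    have h2 : algebraMap S T (m' * d * m : S) * a = algebraMap P T p * algebraMap S T y := by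
      rw [IsScalarTower.algebraMap_apply P S T, ← map_mul, ← hy]
      simp only [map_mul]
      rw [← hs]; ring
    rw [← hu.dvd_mul_left, h2]
    exact dvd_mul_right _ _
  regular a := by
    obtain ⟨⟨s, m⟩, hs⟩ := IsLocalization.surj M a
    obtain ⟨p, hp, b, hb⟩ := h.regular s
    refine ⟨p, hp, algebraMap S T b * algebraMap S T m, ?_⟩
    have hu := IsLocalization.map_units T m
    refine hu.mul_left_cancel ?_
    have h1 := congr_arg (algebraMap S T) hb
    simp only [map_mul, ← IsScalarTower.algebraMap_apply] at h1
    simp only at hs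
    rw [← hs] at h1
    linear_combination h1

/-- Each of the three conditions involves finitely many elements and equations, so it can be checked
at a stage of the filtered colimit. -/
theorem of_ind_etale {P S : CommRingCat.{u}} [IsDomain P] [IsIntegrallyClosed P] (f : P ⟶ S)
    (h : MorphismProperty.ind.{u} (RingHom.toMorphismProperty RingHom.Etale) f) :
    letI := f.hom.toAlgebra
    GenericallyRegular P S := by
  obtain ⟨J, _, _, D, t₀, s₀, hs, hst⟩ := h
  let t : ∀ j, P ⟶ D.obj j := fun j ↦ t₀.app j
  let s : ∀ j, D.obj j ⟶ S := fun j ↦ s₀.app j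
  have hrep : ∀ x : S, ∃ j, ∃ y : D.obj j, s j y = x := fun x ↦
    Concrete.isColimit_exists_rep D hs x
  have hsmap : ∀ {j k} (g : j ⟶ k) (x : D.obj j), s k (D.map g x) = s j x := by
    intro j k g x
    have : D.map g ≫ s k = s j := (s₀.naturality g).trans (Category.comp_id _)
    rw [← this, CommRingCat.comp_apply]
  have heq : ∀ {j} (x y : D.obj j), s j x = s j y →
      ∃ (k : J) (g : j ⟶ k), D.map g x = D.map g y := fun {j} x y hxy ↦ by
    obtain ⟨k, g, g', hg⟩ := Concrete.isColimit_exists_of_rep_eq D hs x y hxy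
    refine ⟨IsFiltered.coeq g g', g ≫ IsFiltered.coeqHom g g', ?_⟩
    conv_rhs => rw [IsFiltered.coeq_condition]
    simp [hg]
  have htmap : ∀ {j k} (g : j ⟶ k) (x : P), D.map g (t j x) = t k x := by
    intro j k g x
    have : t j ≫ D.map g = t k := by simpa using (t₀.naturality g).symm
    rw [← this, CommRingCat.comp_apply]
  have hts : ∀ j (x : P), s j (t j x) = f x := by
    intro j x
    have : t j ≫ s j = f := (hst j).2
    rw [← this, CommRingCat.comp_apply]
  let (j : J) : Algebra P (D.obj j) := (t j).hom.toAlgebra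
  have hreg : ∀ j, GenericallyRegular P (D.obj j) := by
    intro j
    have : Algebra.Etale P (D.obj j) := (hst j).1
    exact of_etale
  have hpoly : ∀ q : Polynomial S, ∃ j, ∃ q' : Polynomial (D.obj j), q'.map (s j).hom = q := by
    intro q
    induction q using Polynomial.induction_on' with
    | monomial n a =>
      obtain ⟨j, y, rfl⟩ := hrep a
      exact ⟨j, Polynomial.monomial n y, by simp⟩
    | add p q hp hq =>
      obtain ⟨j, p', rfl⟩ := hp
      obtain ⟨k, q', rfl⟩ := hq
      refine ⟨IsFiltered.max j k, p'.map (D.map (IsFiltered.leftToMax j k)).hom +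
        q'.map (D.map (IsFiltered.rightToMax j k)).hom, ?_⟩
      ext n
      simp [Polynomial.coeff_map, hsmap]
  let := f.hom.toAlgebra
  refine ⟨fun p hp ↦ ?_, fun p hp a q hq hqa ↦ ?_, fun a ↦ ?_⟩
  · rw [mem_nonZeroDivisors_iff_left]
    intro x hx
    obtain ⟨j, y, rfl⟩ := hrep x
    obtain ⟨k, g, hg⟩ := heq (t j p * y) 0 (by rw [map_mul, hts, map_zero]; exact hx)
    rw [map_mul, htmap, map_zero] at hg
    have := (mem_nonZeroDivisors_iff_left.mp ((hreg k).nonZeroDivisor p hp)) _ hg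
    rw [← hsmap g, this, map_zero]
  · nontriviality S
    have hnt : ∀ j, Nontrivial (D.obj j) := fun j ↦ (s j).hom.domain_nontrivial
    obtain ⟨j, q', hq', -, hqm⟩ : ∃ j, ∃ q' : Polynomial (D.obj j), q'.map (s j).hom = q ∧
        q'.natDegree = q.natDegree ∧ q'.Monic := by
      obtain ⟨j, q', hq'⟩ := hpoly q
      obtain ⟨q'', h⟩ := Polynomial.lifts_and_natDegree_eq_and_monic (f := (s j).hom)
        (Polynomial.mem_lifts _ |>.mpr ⟨q', hq'⟩) hq
      exact ⟨j, q'', h⟩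
    obtain ⟨k, y, rfl⟩ := hrep a
    let l := IsFiltered.max j k
    let q₁ : Polynomial (D.obj l) := q'.map (D.map (IsFiltered.leftToMax j k)).hom
    let y₁ : D.obj l := D.map (IsFiltered.rightToMax j k) y
    have hq₁ : q₁.Monic := hqm.map _
    have hmap : ∀ {A B : Type u} [CommRing A] [CommRing B] [Nontrivial B] (φ : A →+* B)
        (F : Polynomial A) (r x : A), F.Monic →
        φ ((F.scaleRoots r).eval x) = ((F.map φ).scaleRoots (φ r)).eval (φ x) := by
      intro A B _ _ _ φ F r x hF
      rw [← Polynomial.map_scaleRoots _ _ _ (by rw [hF.leadingCoeff, map_one]; exact one_ne_zero),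
        Polynomial.eval_map_apply]
    obtain ⟨m, g, hg⟩ := heq ((q₁.scaleRoots (t l p)).eval y₁) 0 (by
      rw [map_zero]
      refine (hmap (s l).hom q₁ _ _ hq₁).trans ?_
      have h1 : q₁.map (s l).hom = q := by
        rw [← hq']
        ext n
        simp [q₁, Polynomial.coeff_map, hsmap]
      have h2 : (s l).hom y₁ = s k y := hsmap _ _
      have h3 : (s l).hom (t l p) = f p := hts _ _
      rw [h1, h2, h3]
      exact hqa)
    rw [map_zero] at hg
    obtain ⟨z, hz⟩ := (hreg m).dvd_of_integral p hp (D.map g y₁) (q₁.map (D.map g).hom)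
      (hq₁.map _) (by
        have h3 : (D.map g).hom (t l p) = t m p := htmap _ _
        have := hmap (D.map g).hom q₁ (t l p) y₁ hq₁
        rw [h3] at this
        exact this.symm.trans hg)
    refine ⟨s m z, ?_⟩
    have h4 := congr_arg (s m) hz
    rw [hsmap, hsmap] at h4
    rw [h4, map_mul]
    exact congr_arg (· * _) (hts m p)
  · obtain ⟨j, y, rfl⟩ := hrep a
    obtain ⟨p, hp, b, hb⟩ := (hreg j).regular y
    refine ⟨p, hp, s j b, ?_⟩
    rw [← map_mul, ← map_mul, ← hb, map_mul]
    exact congr_arg (· * _) (hts j p).symm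

end GenericallyRegular

/-- Near `m`, a smooth algebra is étale over a polynomial ring over a field, which is a normal
domain. `GenericallyRegular` passes along the étale map and the localization, and over a local ring
it yields normality. -/
theorem isDomain_isIntegrallyClosed_of_smooth {K S T : Type u} [CommRing K] (hK : IsField K)
    [CommRing S] [Algebra K S] [Algebra.Smooth K S] (m : Ideal S) [m.IsPrime] [CommRing T]
    [Algebra S T] [IsLocalization.AtPrime T m] : IsDomain T ∧ IsIntegrallyClosed T := by
  obtain ⟨f, hf, n, _, _, _⟩ :=
    Algebra.IsSmoothAt.exists_isStandardEtale_mvPolynomial (R := K) (p := m)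
  have hdom : IsDomain K := hK.isDomain
  have hufd : UniqueFactorizationMonoid K := by
    let := hK.toField
    infer_instance
  have hle : Submonoid.powers f ≤ m.primeCompl := by
    rw [Submonoid.powers_le]
    exact hf
  let ψ : Localization.Away f →+* T := IsLocalization.lift (M := Submonoid.powers f)
    (g := algebraMap S T) fun y ↦ IsLocalization.map_units T
      (⟨y.1, hle y.2⟩ : m.primeCompl)
  let := ψ.toAlgebra
  have : IsScalarTower S (Localization.Away f) T := .of_algebraMap_eq' (by
    ext x
    simp [RingHom.algebraMap_toAlgebra, ψ])
  have hloc := IsLocalization.isLocalization_of_submonoid_le (Localization.Away f) T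
    (Submonoid.powers f) m.primeCompl hle
  let P := MvPolynomial (Fin n) K
  let := (ψ.comp (algebraMap P (Localization.Away f))).toAlgebra
  have : IsScalarTower P (Localization.Away f) T := .of_algebraMap_eq' rfl
  have h1 : GenericallyRegular P (Localization.Away f) := .of_etale
  have h2 : GenericallyRegular P T := .of_isLocalization (S := Localization.Away f)
    (m.primeCompl.map (algebraMap S (Localization.Away f))) h1
  have : IsLocalRing T := IsLocalization.AtPrime.isLocalRing T m
  exact ⟨h2.isDomain, h2.isIntegrallyClosed⟩

theorem isDomain_isIntegrallyClosed_stalk {k : Type u} [Field k] {Y : Scheme.{u}}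
    (g : Y ⟶ Spec (.of k)) [LocallyOfFinitePresentation g] (y : Y) (hy : y ∈ g.smoothLocus) :
    IsDomain (Y.presheaf.stalk y) ∧ IsIntegrallyClosed (Y.presheaf.stalk y) := by
  obtain ⟨U, hU, V, hV, hVU, hyV, hsm⟩ := exists_smooth_of_formallySmooth_stalk g y hy
  have hK : IsField Γ(Spec (.of k), U) := by
    have hU' : U = ⊤ := by
      ext z
      simp only [TopologicalSpace.Opens.coe_top, Set.mem_univ, iff_true]
      rw [Subsingleton.elim z (g y)]
      exact hVU hyV
    subst hU'
    exact (Scheme.ΓSpecIso (.of k)).commRingCatIsoToRingEquiv.toMulEquiv.isField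
      (Field.toIsField k)
  algebraize [(g.appLE U V hVU).hom]
  let := TopCat.Presheaf.algebra_section_stalk Y.presheaf (⟨y, hyV⟩ : V)
  have := hV.isLocalization_stalk ⟨y, hyV⟩
  exact isDomain_isIntegrallyClosed_of_smooth hK (hV.primeIdealOf ⟨y, hyV⟩).asIdeal

theorem IsHenselization.isDomain_isIntegrallyClosed {A R : Type u} [CommRing A] [IsLocalRing A]
    [IsDomain A] [IsIntegrallyClosed A] [CommRing R] [Algebra A R] (h : IsHenselization A R) :
    IsDomain R ∧ IsIntegrallyClosed R := by
  have := h.henselian.toIsLocalRing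
  have h1 : GenericallyRegular A R := by
    have := GenericallyRegular.of_ind_etale
      (CommRingCat.ofHom (algebraMap A R)) h.indEtale
    have e : (CommRingCat.ofHom (algebraMap A R)).hom.toAlgebra = ‹Algebra A R› :=
      Algebra.algebra_ext _ _ fun _ ↦ rfl
    rwa [e] at this
  exact ⟨h1.isDomain, h1.isIntegrallyClosed⟩

/-! ### Reducedness and units -/

theorem isReduced_of_etale {P S : Type u} [CommRing P] [IsDomain P] [CommRing S] [Algebra P S]
    [Algebra.Etale P S] : IsReduced S := by
  let K := FractionRing P
  have : IsReduced (K ⊗[P] S) := by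
    exact Algebra.FormallyUnramified.isReduced_of_field K _
  have hinj : Function.Injective (Algebra.TensorProduct.includeRight : S →ₐ[P] K ⊗[P] S) :=
    Algebra.TensorProduct.includeRight_injective (IsFractionRing.injective P K)
  exact isReduced_of_injective _ hinj

/-- Locally a smooth algebra is étale over a polynomial ring over the domain `R`; the annihilator of
a nilpotent therefore lies in no maximal ideal. -/
theorem isReduced_of_smooth {R A : Type u} [CommRing R] [IsDomain R] [CommRing A]
    [Algebra R A] [Algebra.Smooth R A] : IsReduced A := by
  refine ⟨fun x hx ↦ ?_⟩
  have h1 : (⊥ : Ideal A).colon {x} = ⊤ := by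
    by_contra hne
    obtain ⟨m, hm, hle⟩ := Ideal.exists_le_maximal _ hne
    obtain ⟨f, hf, n, _, _, _⟩ :=
      Algebra.IsSmoothAt.exists_isStandardEtale_mvPolynomial (R := R) (p := m)
    have : IsReduced (Localization.Away f) := isReduced_of_etale (P := MvPolynomial (Fin n) R)
    have h0 : algebraMap A (Localization.Away f) x = 0 := (hx.map _).eq_zero
    obtain ⟨⟨_, N, rfl⟩, hN⟩ :=
      (IsLocalization.map_eq_zero_iff (Submonoid.powers f) (Localization.Away f) x).mp h0
    exact hf (hm.isPrime.mem_of_pow_mem N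
      (hle (Submodule.mem_colon_singleton.mpr (by simpa using hN))))
  simpa using Submodule.mem_colon_singleton.mp ((Ideal.eq_top_iff_one _).mp h1)

/-- A homomorphism from a local ring to a polynomial ring over a reduced ring is constant. -/
theorem range_le_of_isLocalRing {R A : Type*} [CommRing R] [IsLocalRing R] [CommRing A] [IsReduced A]
    (φ : R →+* A[X]) (r : R) : φ r = Polynomial.C ((φ r).coeff 0) := by
  have hunit : ∀ r : R, IsUnit r → φ r = Polynomial.C ((φ r).coeff 0) := by
    intro r hr
    refine Polynomial.eq_C_of_natDegree_eq_zero ?_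
    by_contra h0
    exact Polynomial.not_isUnit_of_natDegree_pos_of_isReduced _ (Nat.pos_of_ne_zero h0) (hr.map φ)
  -- Units of `A[X]` are constant, and in a local ring `r` or `1 - r` is a unit.
  rcases IsLocalRing.isUnit_or_isUnit_one_sub_self r with h | h
  · exact hunit r h
  · have h1 := hunit _ h
    have h2 : φ r = 1 - φ (1 - r) := by simp
    rw [h2, h1]
    simp [Polynomial.coeff_one]

/-! ### Ideal sheaves generated by global sections -/

open Scheme.IdealSheafData

theorem ofIdealTop_le_ker_iff {X Z : Scheme.{u}} (g : Z ⟶ X) (I : Ideal Γ(X, ⊤)) :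
    ofIdealTop I ≤ g.ker ↔ I ≤ RingHom.ker g.appTop.hom := by
  constructor
  · intro h s hs
    rw [RingHom.mem_ker]
    refine TopCat.Presheaf.section_ext Z.sheaf _ _ _ fun z _ ↦ ?_
    obtain ⟨_, ⟨U, hU, rfl⟩, hzU, -⟩ :=
      X.isBasis_affineOpens.exists_subset_of_mem_open (Set.mem_univ (g z)) isOpen_univ
    have h1 : X.presheaf.map (homOfLE le_top).op s ∈ (ofIdealTop I).ideal ⟨U, hU⟩ :=
      Ideal.mem_map_of_mem _ hs
    have h2 : g.app U (X.presheaf.map (homOfLE le_top).op s) = 0 := g.ideal_ker_le _ (h _ h1)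
    rw [← CommRingCat.comp_apply, g.naturality, CommRingCat.comp_apply] at h2
    have h3 := congr_arg (Z.presheaf.germ (g ⁻¹ᵁ U) z hzU) h2
    rw [map_zero] at h3
    exact ((Z.presheaf.germ_res_apply (homOfLE le_top) z hzU (g.app ⊤ s)).symm.trans h3).trans
      (map_zero _).symm
  · intro h
    rw [Scheme.Hom.ker, le_ofIdeals_iff]
    intro U
    rw [ofIdealTop_ideal, Ideal.map_le_iff_le_comap]
    intro s hs
    rw [Ideal.mem_comap, RingHom.mem_ker]
    change g.app U (X.presheaf.map (homOfLE le_top).op s) = 0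
    rw [← CommRingCat.comp_apply, g.naturality, CommRingCat.comp_apply]
    have : g.app ⊤ s = 0 := h hs
    rw [this, map_zero]

theorem comap_ofIdealTop {X Z : Scheme.{u}} (f : Z ⟶ X) (I : Ideal Γ(X, ⊤)) :
    (ofIdealTop I).comap f = ofIdealTop (I.map f.appTop.hom) := by
  refine eq_of_forall_ge_iff fun K ↦ ?_
  rw [← le_map_iff_comap_le]
  conv_rhs => rw [← K.ker_subschemeι]
  rw [Scheme.IdealSheafData.map, ofIdealTop_le_ker_iff, ofIdealTop_le_ker_iff,
    Ideal.map_le_iff_le_comap, RingHom.comap_ker]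
  rfl

theorem comap_idealSheaf {R : Type u} [CommRing R] {Z : Scheme.{u}} (f : Z ⟶ Spec (.of R))
    (I : Ideal R) : (idealSheaf I).comap f =
      ofIdealTop (I.map (f.appTop.hom.comp (Scheme.ΓSpecIso (.of R)).inv.hom)) := by
  rw [idealSheaf, comap_ofIdealTop, Ideal.map_map]

theorem comap_idealSheaf_span {R : Type u} [CommRing R] {Z : Scheme.{u}} (f : Z ⟶ Spec (.of R))
    (r : R) : (idealSheaf (Ideal.span {r})).comap f = sectionIdeal (pullbackSection f r) := by
  rw [comap_idealSheaf, Ideal.map_span, Set.image_singleton]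
  rfl

theorem comap_specMap_idealSheaf {R S : Type u} [CommRing R] [CommRing S] (φ : R →+* S)
    (I : Ideal R) :
    (idealSheaf I).comap (Spec.map (CommRingCat.ofHom φ)) = idealSheaf (I.map φ) := by
  rw [comap_idealSheaf, idealSheaf, Ideal.map_map]
  congr 2
  rw [← CommRingCat.hom_comp, ← Scheme.ΓSpecIso_inv_naturality]
  rfl

theorem idealSheaf_mono_iff {R : Type u} [CommRing R] {I J : Ideal R} :
    idealSheaf I ≤ idealSheaf J ↔ I ≤ J := by
  have h : Function.Bijective (Scheme.ΓSpecIso (.of R)).inv.hom :=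
    ConcreteCategory.bijective_of_isIso (Scheme.ΓSpecIso (.of R)).inv
  rw [idealSheaf, idealSheaf, ← equivOfIsAffine_symm_apply, ← equivOfIsAffine_symm_apply,
    map_le_map_iff, Ideal.map_le_iff_le_comap, Ideal.comap_map_of_bijective _ h]

theorem idealSheaf_injective {R : Type u} [CommRing R] :
    Function.Injective (idealSheaf (R := R)) := fun _ _ h ↦
  le_antisymm (idealSheaf_mono_iff.mp h.le) (idealSheaf_mono_iff.mp h.ge)

theorem exists_eq_idealSheaf {R : Type u} [CommRing R] (J : (Spec (.of R)).IdealSheafData) :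
    ∃ I : Ideal R, J = idealSheaf I := by
  refine ⟨(J.ideal ⟨⊤, isAffineOpen_top _⟩).comap (Scheme.ΓSpecIso (.of R)).inv.hom, ?_⟩
  rw [idealSheaf, Ideal.map_comap_of_surjective _
    (ConcreteCategory.bijective_of_isIso (Scheme.ΓSpecIso (.of R)).inv).2]
  exact (equivOfIsAffine.symm_apply_apply J).symm

theorem mem_support_idealSheaf {R : Type u} [CommRing R] (I : Ideal R) (P : Spec (.of R)) :
    P ∈ (idealSheaf I).support ↔ I ≤ P.asIdeal := by
  have : P ∈ (idealSheaf I).support ↔ P ∈ ((idealSheaf I).support : Set (Spec (.of R))) := .rfl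
  rw [this, idealSheaf, coe_support_ofIdealTop, Ideal.map, Scheme.zeroLocus_span,
    Spec_zeroLocus_eq_zeroLocus]
  rfl

/-! ### Equality of ideal sheaves is local -/

theorem ext_of_openImmersion {X : Scheme.{u}} {I J : X.IdealSheafData}
    (h : ∀ x : X, ∃ (U : Scheme.{u}) (f : U ⟶ X) (_ : IsOpenImmersion f), x ∈ Set.range f ∧
      I.comap f = J.comap f) : I = J := by
  have (x : X) : ∃ U : X.affineOpens, x ∈ U.1 ∧ I.ideal U = J.ideal U := by
    obtain ⟨U, f, _, ⟨z, rfl⟩, hU⟩ := h x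
    obtain ⟨_, ⟨W, hW, rfl⟩, hzW, -⟩ :=
      U.isBasis_affineOpens.exists_subset_of_mem_open (Set.mem_univ z) isOpen_univ
    refine ⟨⟨f ''ᵁ W, hW.image_of_isOpenImmersion f⟩, ⟨z, hzW, rfl⟩, ?_⟩
    have h1 := congr_arg (fun K ↦ K.ideal ⟨W, hW⟩) hU
    simp only [ideal_comap_of_isOpenImmersion] at h1
    exact Ideal.comap_injective_of_surjective _
      (ConcreteCategory.bijective_of_isIso (f.appIso W).inv).2 h1
  choose U hU h using this
  exact ext_of_iSup_eq_top U (by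
    rw [eq_top_iff]
    exact fun x _ ↦ TopologicalSpace.Opens.mem_iSup.mpr ⟨x, hU x⟩) h

/-- Passing to `I ⊔ J` allows `I ≤ J`. The preimage in `V` of the subscheme of `I` then maps to that
of `J`; since étale surjections are effective epimorphisms, this map descends to the subscheme of
`I`, giving `J ≤ I`. -/
theorem comap_injective_of_etale {V X : Scheme.{u}} (p : V ⟶ X) [Etale p] [Surjective p]
    {I J : X.IdealSheafData} (h : I.comap p = J.comap p) : I = J := by
  suffices ∀ I J : X.IdealSheafData, I ≤ J → I.comap p = J.comap p → J ≤ I by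
    have h1 := this I (I ⊔ J) le_sup_left (by rw [comap_sup, h, sup_idem])
    have h2 := this J (I ⊔ J) le_sup_right (by rw [comap_sup, h, sup_idem])
    exact le_antisymm (le_sup_left.trans h2) (le_sup_right.trans h1)
  intro I J hIJ h
  let q : pullback p I.subschemeι ⟶ I.subscheme := pullback.snd _ _
  have hle : J ≤ (pullback.fst p I.subschemeι ≫ p).ker := by
    have : J.comap p ≤ (pullback.fst p I.subschemeι).ker := h.ge
    rw [← le_map_iff_comap_le] at this
    rwa [Scheme.Hom.ker_comp]
  let g : pullback p I.subschemeι ⟶ J.subscheme :=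
    IsClosedImmersion.lift J.subschemeι (pullback.fst p I.subschemeι ≫ p)
      (by rwa [ker_subschemeι])
  have hg : g ≫ J.subschemeι = q ≫ I.subschemeι := by
    rw [← pullback.condition]
    exact IsClosedImmersion.lift_fac _ _ _
  let d : I.subscheme ⟶ J.subscheme := EffectiveEpi.desc q g fun g₁ g₂ h12 ↦ by
    rw [← cancel_mono J.subschemeι, Category.assoc, Category.assoc, hg, reassoc_of% h12]
  have hd : d ≫ J.subschemeι = I.subschemeι := by
    rw [← cancel_epi q, ← hg, ← Category.assoc, EffectiveEpi.fac]
  rw [← I.ker_subschemeι, ← hd]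
  conv_lhs => rw [← J.ker_subschemeι]
  exact Scheme.Hom.le_ker_comp _ _

instance isZariskiLocalAtSource_etale :
    IsZariskiLocalAtSource (@Etale : MorphismProperty Scheme.{u}) :=
  HasRingHomProperty.instIsZariskiLocalAtSource (Q := RingHom.Etale)

theorem ext_of_etale {X : Scheme.{u}} {I J : X.IdealSheafData}
    (h : ∀ x : X, ∃ (U : Scheme.{u}) (f : U ⟶ X) (_ : Etale f), x ∈ Set.range f ∧
      I.comap f = J.comap f) : I = J := by
  choose U f hf hx h using h
  have : Etale (Sigma.desc f) :=
    IsZariskiLocalAtSource.sigmaDesc (P := (@Etale : MorphismProperty Scheme.{u})) hf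
  have : Surjective (Sigma.desc f) := ⟨fun x ↦ by
    obtain ⟨z, hz⟩ := hx x
    refine ⟨Sigma.ι U x z, ?_⟩
    rw [← Scheme.Hom.comp_apply, Sigma.ι_desc, hz]⟩
  refine comap_injective_of_etale (Sigma.desc f) (ext_of_openImmersion fun z ↦ ?_)
  obtain ⟨i, w, rfl⟩ : ∃ (i : X) (w : U i), Sigma.ι U i w = z := (sigmaOpenCover U).exists_eq z
  refine ⟨U i, Sigma.ι U i, inferInstance, ⟨w, rfl⟩, ?_⟩
  rw [← comap_comp, ← comap_comp, Sigma.ι_desc, h]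

/-! ### Locally principal ideal sheaves -/

/-- An ideal sheaf which is locally generated by one section. -/
def IsLocallyPrincipal {X : Scheme.{u}} (J : X.IdealSheafData) : Prop :=
  ∀ x : X, ∃ (U : Scheme.{u}) (f : U ⟶ X) (_ : IsOpenImmersion f), x ∈ Set.range f ∧
    ∃ a : Γ(U, ⊤), J.comap f = sectionIdeal a

theorem comap_sectionIdeal {X Z : Scheme.{u}} (f : Z ⟶ X) (a : Γ(X, ⊤)) :
    (sectionIdeal a).comap f = sectionIdeal (f.appTop a) := by
  rw [sectionIdeal, comap_ofIdealTop, Ideal.map_span, Set.image_singleton]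

/-- This is why no nonzerodivisor condition is imposed: effective Cartier divisors are not stable
under arbitrary pullback, locally principal ideals are. -/
theorem IsLocallyPrincipal.comap {X Z : Scheme.{u}} {J : X.IdealSheafData}
    (hJ : IsLocallyPrincipal J) (g : Z ⟶ X) : IsLocallyPrincipal (J.comap g) := by
  intro z
  obtain ⟨U, f, _, hx, a, ha⟩ := hJ (g z)
  refine ⟨pullback g f, pullback.fst g f, inferInstance, ?_, (pullback.snd g f).appTop a, ?_⟩
  · rw [IsOpenImmersion.range_pullbackFst]
    exact hx
  · rw [← comap_comp, pullback.condition, comap_comp, ha, comap_sectionIdeal]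

theorem IsEffectiveCartier.isLocallyPrincipal {X : Scheme.{u}} {J : X.IdealSheafData}
    (hJ : IsEffectiveCartier J) : IsLocallyPrincipal J := by
  intro x
  obtain ⟨W, hx, a, -, ha⟩ := hJ x
  have : IsAffine W.1 := W.2
  refine ⟨W.1, W.1.ι, inferInstance, by simpa using hx, ?_⟩
  have h1 : IsAffineOpen (W.1.ι ''ᵁ ⊤) := by
    rw [W.1.ι_image_top]
    exact W.2
  obtain ⟨a, ha⟩ : ∃ a : Γ(X, W.1.ι ''ᵁ ⊤), J.ideal ⟨_, h1⟩ = Ideal.span {a} := by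
    have : (⟨_, h1⟩ : X.affineOpens) = W := Subtype.ext (by simp)
    suffices ∀ W' : X.affineOpens, W' = W → ∃ a : Γ(X, W'.1), J.ideal W' = Ideal.span {a} from
      this _ ‹_›
    rintro _ rfl
    exact ⟨a, ha⟩
  have hbij := ConcreteCategory.bijective_of_isIso (W.1.ι.appIso ⊤).inv
  obtain ⟨c, rfl⟩ := hbij.2 a
  refine ⟨c, ext_of_isAffine ?_⟩
  rw [ideal_comap_of_isOpenImmersion, ha]
  have : Ideal.span {(W.1.ι.appIso ⊤).inv c} =
      (Ideal.span {c}).map (W.1.ι.appIso ⊤).inv.hom := by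
    rw [Ideal.map_span, Set.image_singleton]
  rw [this, Ideal.comap_map_of_bijective _ hbij]
  exact (equivOfIsAffine.apply_symm_apply (Ideal.span {c})).symm

/-- Being locally principal, `J` is finitely generated, so one power of `s` clears the denominators
for all generators at once. -/
theorem exists_dvd_mul_of_locally_principal {B : Type*} [CommRing B] {J : Ideal B}
    (h : ∀ P : Ideal B, P.IsPrime → ∃ s ∉ P, ∃ a : Localization.Away s,
      J.map (algebraMap B (Localization.Away s)) = Ideal.span {a})
    (P : Ideal B) (hP : P.IsPrime) : ∃ s ∉ P, ∃ f ∈ J, ∀ j ∈ J, f ∣ s * j := by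
  let t : Set B := {s | ∃ a : Localization.Away s,
      J.map (algebraMap B (Localization.Away s)) = Ideal.span {a}}
  have ht : Ideal.span t = ⊤ := by
    by_contra htop
    obtain ⟨M, hM, hle⟩ := Ideal.exists_le_maximal _ htop
    obtain ⟨s, hs, hs'⟩ := h M hM.isPrime
    exact hs (hle (Ideal.subset_span hs'))
  have hfg : J.FG := by
    refine Ideal.fg_of_localizationSpan t ht fun s ↦ ?_
    obtain ⟨a, ha⟩ := s.2
    rw [ha]
    exact ⟨{a}, by simp⟩
  obtain ⟨s, hs, a, ha⟩ := h P hP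
  have ha' : a ∈ J.map (algebraMap B (Localization.Away s)) := ha ▸ Ideal.mem_span_singleton_self a
  obtain ⟨⟨⟨f, hf⟩, m⟩, hfm⟩ :=
    (IsLocalization.mem_map_algebraMap_iff (Submonoid.powers s) _).mp ha'
  have key (j : B) (hj : j ∈ J) : ∃ N, f ∣ s ^ N * j := by
    have hj' : algebraMap B (Localization.Away s) j ∈ Ideal.span {a} :=
      ha ▸ Ideal.mem_map_of_mem _ hj
    obtain ⟨b, hb⟩ := Ideal.mem_span_singleton'.mp hj'
    obtain ⟨⟨b', m'⟩, hbm⟩ := IsLocalization.surj (Submonoid.powers s) b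
    have h1 : algebraMap B (Localization.Away s) (m.1 * m'.1 * j) =
        algebraMap B (Localization.Away s) (f * b') := by
      rw [map_mul, map_mul, map_mul, ← hbm, ← hfm, ← hb]
      ring
    obtain ⟨e, he⟩ := (IsLocalization.eq_iff_exists (Submonoid.powers s) _).mp h1
    obtain ⟨N, hN⟩ := (e * m * m').2
    refine ⟨N, e.1 * b', ?_⟩
    have : s ^ N = e.1 * m.1 * m'.1 := hN
    rw [this]
    linear_combination he
  choose! N hN using key
  obtain ⟨S, rfl⟩ := hfg
  refine ⟨s ^ (S.sup N), fun hmem ↦ hs (hP.mem_of_pow_mem _ hmem), f, hf, fun j hj ↦ ?_⟩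
  induction hj using Submodule.span_induction with
  | mem x hx =>
    have hle : N x ≤ S.sup N := Finset.le_sup hx
    refine (hN x (Ideal.subset_span hx)).trans (mul_dvd_mul_right (pow_dvd_pow s hle) x)
  | zero => simp
  | add x y _ _ hx hy => rw [mul_add]; exact dvd_add hx hy
  | smul b x _ hx => rw [smul_eq_mul, mul_left_comm]; exact hx.mul_left b

theorem sectionIdeal_eq_idealSheaf {R : Type u} [CommRing R] (a : Γ(Spec (.of R), ⊤)) :
    sectionIdeal a = idealSheaf (Ideal.span {(Scheme.ΓSpecIso (.of R)).hom a}) := by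
  rw [idealSheaf, Ideal.map_span, Set.image_singleton]
  congr 3
  exact ((Scheme.ΓSpecIso (.of R)).hom_inv_id_apply a).symm

theorem exists_mul_eq_span_of_isLocallyPrincipal {B : Type u} [CommRing B] {J : Ideal B}
    (hJ : IsLocallyPrincipal (idealSheaf J)) {c : B} (hc : c ∈ J) :
    ∃ L : Ideal B, J * L = Ideal.span {c} := by
  refine exists_mul_eq_span_of_locally_principal hc
    (exists_dvd_mul_of_locally_principal fun P hP ↦ ?_)
  obtain ⟨U, f, _, hPf, a, ha⟩ := hJ ⟨P, hP⟩
  obtain ⟨_, ⟨_, ⟨s, rfl⟩, rfl⟩, hs, hsub⟩ :=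
    PrimeSpectrum.isBasis_basic_opens.exists_subset_of_mem_open hPf f.isOpenEmbedding.isOpen_range
  refine ⟨s, hs, ?_⟩
  let i : Spec (.of (Localization.Away s)) ⟶ Spec (.of B) :=
    Spec.map (CommRingCat.ofHom (algebraMap B (Localization.Away s)))
  have hi : Set.range i ⊆ Set.range f := by
    refine subset_trans (le_of_eq ?_) hsub
    exact PrimeSpectrum.localization_away_comap_range _ s
  let l := IsOpenImmersion.lift f i hi
  have h1 : (idealSheaf J).comap i = sectionIdeal (l.appTop a) := by
    rw [← IsOpenImmersion.lift_fac f i hi, comap_comp, ha, comap_sectionIdeal]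
  rw [comap_specMap_idealSheaf, sectionIdeal_eq_idealSheaf] at h1
  exact ⟨_, idealSheaf_injective h1⟩

/-- An ideal sheaf over `Spec R` whose support avoids the generic fibre contains a nonzero
constant. -/
theorem exists_ne_zero_mem_of_support {R B : Type u} [CommRing R] [IsDomain R] [CommRing B]
    (φ : R →+* B) {J : Ideal B}
    (hJ : ∀ P ∈ (idealSheaf J).support,
      ¬ IsGenericPoint (Spec.map (CommRingCat.ofHom φ) P) Set.univ) :
    ∃ c : R, c ≠ 0 ∧ φ c ∈ J := by
  by_contra! hcon
  have hdis : Disjoint (J : Set B) ((nonZeroDivisors R).map φ : Submonoid B) := by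
    rw [Set.disjoint_left]
    rintro _ hx ⟨c, hc, rfl⟩
    exact hcon c (nonZeroDivisors.ne_zero hc) hx
  -- A prime above `J` avoiding all nonzero constants lies in the support and over the generic
  -- point.
  obtain ⟨P, hP, hle, hdisP⟩ := Ideal.exists_le_prime_disjoint J _ hdis
  refine hJ ⟨P, hP⟩ ((mem_support_idealSheaf J _).mpr hle) ?_
  have : Spec.map (CommRingCat.ofHom φ) ⟨P, hP⟩ = (⊥ : PrimeSpectrum R) := by
    refine PrimeSpectrum.ext (le_antisymm (fun c hc ↦ ?_) bot_le)
    by_contra hc0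
    exact Set.disjoint_left.mp hdisP (hc : φ c ∈ P)
      ⟨c, mem_nonZeroDivisors_of_ne_zero hc0, rfl⟩
  rw [this]
  exact isGenericPoint_iff_specializes.mpr fun Q ↦
    ⟨fun _ ↦ trivial, fun _ ↦ (PrimeSpectrum.le_iff_specializes _ _).mp bot_le⟩

/-! ### Morphisms from the affine line to a local scheme -/

/-- The affine line over an affine scheme is the spectrum of the polynomial ring. -/
def line.specIso (A : Type u) [CommRing A] : line (Spec (.of A)) ≅ Spec (.of A[X]) :=
  AffineSpace.SpecIso PUnit (.of A) ≪≫
    Scheme.Spec.mapIso (MvPolynomial.uniqueAlgEquiv A PUnit).toRingEquiv.symm.toCommRingCatIso.op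

theorem line.specIso_inv_proj (A : Type u) [CommRing A] :
    (line.specIso A).inv ≫ line.proj _ = Spec.map (CommRingCat.ofHom Polynomial.C) := by
  rw [line.specIso, Iso.trans_inv, Category.assoc, AffineSpace.SpecIso_inv_over]
  change Spec.map _ ≫ _ = _
  rw [← Spec.map_comp]
  congr 1
  ext a : 2
  exact (MvPolynomial.uniqueAlgEquiv A PUnit).commutes a

theorem line.zero_proj (Y : Scheme.{u}) : line.zero Y ≫ line.proj Y = 𝟙 Y :=
  AffineSpace.homOfVector_over _ _

theorem line.one_proj (Y : Scheme.{u}) : line.one Y ≫ line.proj Y = 𝟙 Y :=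
  AffineSpace.homOfVector_over _ _

theorem line.zero_map {Y Z : Scheme.{u}} (f : Y ⟶ Z) :
    line.zero Y ≫ AffineSpace.map PUnit f = f ≫ line.zero Z := by
  refine AffineSpace.hom_ext ?_ fun i ↦ ?_
  · rw [Category.assoc, AffineSpace.map_over, reassoc_of% line.zero_proj, Category.assoc, line.zero_proj,
      Category.comp_id]
  · rw [Scheme.Hom.comp_appTop, Scheme.Hom.comp_appTop, CommRingCat.comp_apply,
      CommRingCat.comp_apply, AffineSpace.map_appTop_coord, line.zero,
      AffineSpace.homOfVector_appTop_coord, line.zero, AffineSpace.homOfVector_appTop_coord,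
      map_zero]

theorem line.hom_ext {Y Z : Scheme.{u}} {f g : line Y ⟶ Z}
    (h : ∀ (A : Type u) [CommRing A] (i : Spec (.of A) ⟶ Y) [IsOpenImmersion i],
      AffineSpace.map PUnit i ≫ f = AffineSpace.map PUnit i ≫ g) : f = g := by
  refine Scheme.Cover.hom_ext (Y.affineCover.pullback₁ (line.proj Y)) _ _ fun i ↦ ?_
  let j : Spec (.of _) ⟶ Y := Y.affineCover.f i
  have : IsOpenImmersion j := Y.affineCover.map_prop i
  have h1 : (AffineSpace.isPullback_map (n := PUnit) j).isoPullback.hom ≫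
    (Y.affineCover.pullback₁ (line.proj Y)).f i = AffineSpace.map PUnit j :=
    IsPullback.isoPullback_hom_fst _
  refine (cancel_epi (AffineSpace.isPullback_map (n := PUnit) j).isoPullback.hom).mp ?_
  have h2 := h _ j
  rw [← h1] at h2
  exact (Category.assoc _ _ _).symm.trans (h2.trans (Category.assoc _ _ _))

/-- Over an affine `Y` such a morphism is a ring map from a local ring to `A[X]` with `A` reduced,
hence takes constant values. The general case is glued from affine opens. -/
theorem line.eq_proj_zero_comp {R : Type u} [CommRing R] [IsLocalRing R] {Y : Scheme.{u}}
    [IsReduced Y] (h : line Y ⟶ Spec (.of R)) : h = line.proj Y ≫ line.zero Y ≫ h := by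
  have haff (A : Type u) [CommRing A] [_root_.IsReduced A] (h : line (Spec (.of A)) ⟶ Spec (.of R)) :
      h = line.proj _ ≫ line.zero _ ≫ h := by
    obtain ⟨φ, hφ⟩ := Spec.map_surjective ((line.specIso A).inv ≫ h)
    have hfac : h = line.proj _ ≫
        Spec.map (CommRingCat.ofHom (Polynomial.constantCoeff.comp φ.hom)) := by
      rw [← cancel_epi (line.specIso A).inv, ← hφ, reassoc_of% line.specIso_inv_proj, ← Spec.map_comp]
      congr 1
      ext r : 2
      exact range_le_of_isLocalRing φ.hom r
    conv_rhs => rw [hfac, reassoc_of% line.zero_proj]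
    exact hfac
  refine line.hom_ext fun A _ i _ ↦ ?_
  have : IsReduced (Spec (.of A)) := isReduced_of_isOpenImmersion i
  have : _root_.IsReduced A := (affine_isReduced_iff (.of A)).mp this
  rw [haff A (AffineSpace.map PUnit i ≫ h), reassoc_of% line.zero_map, AffineSpace.map_over_assoc]

/-! ### Ideal sheaves on étale covers of the affine line -/

theorem exists_map_eq_of_faithfullyFlat {R A B : Type u} [CommRing R] [IsDomain R]
    [IsIntegrallyClosed R] [CommRing A] [CommRing B] (ψ : R →+* A) (hψ : ψ.Smooth)
    (φ : A[X] →+* B) (hφ : φ.FaithfullyFlat) {J : Ideal B}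
    (hJ : IsLocallyPrincipal (idealSheaf J))
    (hsupp : ∀ P ∈ (idealSheaf J).support, ¬ IsGenericPoint
      (Spec.map (CommRingCat.ofHom ((φ.comp Polynomial.C).comp ψ)) P) Set.univ)
    (hpr : (idealSheaf J).comap
        (pullback.fst (Spec.map (CommRingCat.ofHom φ)) (Spec.map (CommRingCat.ofHom φ))) =
      (idealSheaf J).comap
        (pullback.snd (Spec.map (CommRingCat.ofHom φ)) (Spec.map (CommRingCat.ofHom φ)))) :
    ∃ J₀ : Ideal A, J = (J₀.map Polynomial.C).map φ := by
  obtain ⟨c, hc, hcJ⟩ := exists_ne_zero_mem_of_support _ hsupp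
  obtain ⟨L, hL⟩ := exists_mul_eq_span_of_isLocallyPrincipal hJ hcJ
  algebraize [ψ, φ]
  have : Algebra.Smooth R A := hψ
  have : Module.FaithfullyFlat A[X] B := hφ
  refine exists_map_algebraMap_eq_of_descent hc hL ?_
  have h1 := congr_arg (Scheme.IdealSheafData.comap · (pullbackSpecIso A[X] B B).inv) hpr
  simp only [← comap_comp] at h1
  have h2 : _ ≫ pullback.fst (Spec.map (CommRingCat.ofHom φ)) (Spec.map (CommRingCat.ofHom φ)) = _ :=
    pullbackSpecIso_inv_fst A[X] B B
  have h3 : _ ≫ pullback.snd (Spec.map (CommRingCat.ofHom φ)) (Spec.map (CommRingCat.ofHom φ)) = _ :=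
    pullbackSpecIso_inv_snd A[X] B B
  rw [h2, h3, comap_specMap_idealSheaf, comap_specMap_idealSheaf] at h1
  exact idealSheaf_injective h1

/-- Replaces `V`, possibly not quasi-compact, by an affine scheme: étale maps are open, so finitely
many affine opens of `V` have images covering `L` and also cover `K`; their disjoint union is
affine. -/
theorem exists_etale_spec {V L : Scheme.{u}} [CompactSpace L] (p : V ⟶ L) [Etale p] [Surjective p]
    {K : Set V} (hK : IsCompact K) :
    ∃ (B : Type u) (_ : CommRing B) (w : Spec (.of B) ⟶ V), Etale w ∧ K ⊆ Set.range w ∧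
      Surjective (w ≫ p) := by
  classical
  have hU (v : V) : ∃ U : V.affineOpens, v ∈ U.1 := by
    obtain ⟨_, ⟨U, hU, rfl⟩, hv, -⟩ :=
      V.isBasis_affineOpens.exists_subset_of_mem_open (Set.mem_univ v) isOpen_univ
    exact ⟨⟨U, hU⟩, hv⟩
  choose U hU using hU
  obtain ⟨s, hs⟩ := hK.elim_finite_subcover (fun v ↦ ((U v).1 : Set V)) (fun v ↦ (U v).1.isOpen)
    fun v _ ↦ Set.mem_iUnion.mpr ⟨v, hU v⟩
  obtain ⟨t, ht⟩ := isCompact_univ.elim_finite_subcover (fun v ↦ p '' ((U v).1 : Set V))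
    (fun v ↦ p.isOpenMap _ (U v).1.isOpen) fun x _ ↦ by
      obtain ⟨v, rfl⟩ := p.surjective x
      exact Set.mem_iUnion.mpr ⟨v, v, hU v, rfl⟩
  let F : (s ∪ t : Finset V) → Scheme.{u} := fun v ↦ (U v.1).1
  have hF (v : (s ∪ t : Finset V)) : IsAffine (F v) := (U v.1).2
  let w : ∐ F ⟶ V := Sigma.desc fun v : (s ∪ t : Finset V) ↦ (U v.1).1.ι
  have hw : Etale w :=
    IsZariskiLocalAtSource.sigmaDesc (P := (@Etale : MorphismProperty Scheme.{u}))
      fun v ↦ inferInstanceAs (Etale (U v.1).1.ι)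
  have hmem (v : V) (hv : v ∈ s ∪ t) (z : V) (hz : z ∈ (U v).1) :
      z ∈ Set.range ((∐ F).isoSpec.inv ≫ w) := by
    have h1 : (Sigma.ι F ⟨v, hv⟩ ≫ (∐ F).isoSpec.hom) ≫ (∐ F).isoSpec.inv ≫ w = (U v).1.ι := by
      rw [Category.assoc, Iso.hom_inv_id_assoc]
      exact Sigma.ι_desc _ _
    let z' : F ⟨v, hv⟩ := ⟨z, hz⟩
    refine ⟨(Sigma.ι F ⟨v, hv⟩ ≫ (∐ F).isoSpec.hom) z', ?_⟩
    rw [← Scheme.Hom.comp_apply, h1]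
    rfl
  refine ⟨Γ(∐ F, ⊤), inferInstance, (∐ F).isoSpec.inv ≫ w, inferInstance, fun z hz ↦ ?_,
    ⟨fun x ↦ ?_⟩⟩
  · obtain ⟨v, hv, hz⟩ := Set.mem_iUnion₂.mp (hs hz)
    exact hmem v (Finset.mem_union_left _ hv) z hz
  · obtain ⟨v, hv, z, hz, rfl⟩ := Set.mem_iUnion₂.mp (ht (Set.mem_univ x))
    obtain ⟨y, rfl⟩ := hmem v (Finset.mem_union_right _ hv) z hz
    exact ⟨y, by rw [Scheme.Hom.comp_apply]⟩

theorem comap_fst_eq_comap_snd {V L V' L' : Scheme.{u}} {p : V ⟶ L} {p' : V' ⟶ L'}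
    (w : V' ⟶ V) (l : L' ⟶ L) (h : p' ≫ l = w ≫ p) {J : V.IdealSheafData}
    (hJ : J.comap (pullback.fst p p) = J.comap (pullback.snd p p)) :
    (J.comap w).comap (pullback.fst p' p') = (J.comap w).comap (pullback.snd p' p') := by
  let m : pullback p' p' ⟶ pullback p p :=
    pullback.lift (pullback.fst p' p' ≫ w) (pullback.snd p' p' ≫ w) (by
      rw [Category.assoc, Category.assoc, ← h, pullback.condition_assoc])
  have h1 := congr_arg (Scheme.IdealSheafData.comap · m) hJ
  simp only [← comap_comp] at h1 ⊢
  rwa [pullback.lift_fst, pullback.lift_snd] at h1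

theorem eq_comap_section_of_spec {R A : Type u} [CommRing R] [IsDomain R] [IsIntegrallyClosed R]
    [CommRing A] (τ : Spec (.of A) ⟶ Spec (.of R)) [Smooth τ] {V : Scheme.{u}}
    (p : V ⟶ line (Spec (.of A))) [Etale p] [Surjective p] (σ : Spec (.of A) ⟶ V)
    (hσ : σ ≫ p ≫ line.proj _ = 𝟙 _) {J : V.IdealSheafData} (hJ : IsLocallyPrincipal J)
    (hsupp : ∀ v ∈ J.support, ¬ IsGenericPoint ((p ≫ line.proj _ ≫ τ) v) Set.univ)
    (hpr : J.comap (pullback.fst p p) = J.comap (pullback.snd p p)) :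
    J = (J.comap σ).comap (p ≫ line.proj _) := by
  have : CompactSpace (line (Spec (.of A))) :=
    (Scheme.homeoOfIso (line.specIso A)).symm.compactSpace
  refine ext_of_etale fun v ↦ ?_
  -- The affine replacement must see `v`, where equality is tested, and the whole image of `σ`, so
  -- that the descended ideal can be read off along `σ`.
  obtain ⟨B, _, w, hw, hsub, hsurj⟩ := exists_etale_spec p
    ((isCompact_range σ.continuous).union (isCompact_singleton (x := v)))
  refine ⟨_, w, hw, hsub (Set.mem_union_right _ rfl), ?_⟩
  obtain ⟨φ, hφ⟩ := Spec.map_surjective (w ≫ p ≫ (line.specIso A).hom)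
  obtain ⟨ψ, rfl⟩ := Spec.map_surjective τ
  have hψ : ψ.hom.Smooth := (HasRingHomProperty.Spec_iff (P := @Smooth)).mp inferInstance
  have hff : φ.hom.FaithfullyFlat := by
    have h1 : Flat (w ≫ p ≫ (line.specIso A).hom) := inferInstance
    have h2 : Surjective ((w ≫ p) ≫ (line.specIso A).hom) := inferInstance
    rw [Category.assoc] at h2
    rw [← hφ] at h1 h2
    exact (flat_and_surjective_SpecMap_iff φ).mp ⟨h1, h2⟩
  obtain ⟨J', hJ'⟩ := exists_eq_idealSheaf (J.comap w)
  have hC : Spec.map φ ≫ Spec.map (CommRingCat.ofHom Polynomial.C) = w ≫ p ≫ line.proj _ := by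
    rw [hφ, ← line.specIso_inv_proj]
    simp
  obtain ⟨J₀, rfl⟩ := exists_map_eq_of_faithfullyFlat ψ.hom hψ φ.hom hff (hJ' ▸ hJ.comap w)
    (fun P hP ↦ by
      have h1 : Spec.map (CommRingCat.ofHom ((φ.hom.comp Polynomial.C).comp ψ.hom)) =
          w ≫ p ≫ line.proj _ ≫ Spec.map ψ := by
        rw [← Category.assoc p, ← Category.assoc w, ← hC, ← Spec.map_comp, ← Spec.map_comp]
        rfl
      rw [h1, Scheme.Hom.comp_apply]
      rw [← hJ', support_comap] at hP
      exact hsupp _ hP)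
    (by
      rw [← hJ']
      exact comap_fst_eq_comap_snd w (line.specIso A).inv (by
        change Spec.map φ ≫ _ = _
        rw [hφ]
        simp) hpr)
  have hJw : J.comap w = (idealSheaf J₀).comap (w ≫ p ≫ line.proj _) := by
    rw [hJ', ← hC, comap_comp, comap_specMap_idealSheaf]
    exact (comap_specMap_idealSheaf φ.hom _).symm
  -- Since the image of `σ` lies in that of `w`, the base change of `w` along `σ` is an étale
  -- surjection, on which the two ideals can be compared.
  have hsec : idealSheaf J₀ = J.comap σ := by
    have : Surjective (pullback.snd w σ) := ⟨by
      rw [← Set.range_eq_univ, Scheme.Pullback.range_snd, Set.eq_univ_iff_forall]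
      exact fun x ↦ hsub (Set.mem_union_left _ ⟨x, rfl⟩)⟩
    refine comap_injective_of_etale (pullback.snd w σ) ?_
    rw [← comap_comp, ← pullback.condition, comap_comp, hJw, ← comap_comp,
      pullback.condition_assoc, hσ, Category.comp_id]
  rw [hJw, hsec, ← comap_comp, ← comap_comp, ← comap_comp, Category.assoc, Category.assoc]

/-- All the data are base changed along an affine open of `Y` containing the image of the given
point of `V`. -/
theorem eq_comap_section {R : Type u} [CommRing R] [IsDomain R] [IsIntegrallyClosed R]
    {Y : Scheme.{u}} (τ : Y ⟶ Spec (.of R)) [Smooth τ] {V : Scheme.{u}}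
    (p : V ⟶ line Y) [Etale p] [Surjective p] (σ : Y ⟶ V)
    (hσ : σ ≫ p ≫ line.proj _ = 𝟙 _) {J : V.IdealSheafData} (hJ : IsLocallyPrincipal J)
    (hsupp : ∀ v ∈ J.support, ¬ IsGenericPoint ((p ≫ line.proj _ ≫ τ) v) Set.univ)
    (hpr : J.comap (pullback.fst p p) = J.comap (pullback.snd p p)) :
    J = (J.comap σ).comap (p ≫ line.proj _) := by
  refine ext_of_openImmersion fun v ↦ ?_
  obtain ⟨A, _, i, _, hi⟩ : ∃ (A : Type u) (_ : CommRing A) (i : Spec (.of A) ⟶ Y)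
      (_ : IsOpenImmersion i), (p ≫ line.proj Y) v ∈ Set.range i := by
    obtain ⟨j, y, hy⟩ := Y.affineCover.exists_eq ((p ≫ line.proj Y) v)
    exact ⟨_, inferInstance, Y.affineCover.f j, Y.affineCover.map_prop j, y, hy⟩
  let f : pullback (p ≫ line.proj Y) i ⟶ V := pullback.fst _ _
  let g : pullback (p ≫ line.proj Y) i ⟶ Spec (.of A) := pullback.snd _ _
  have hfg : f ≫ p ≫ line.proj Y = g ≫ i := pullback.condition
  have hline := AffineSpace.isPullback_map (n := PUnit) i
  let p' : pullback (p ≫ line.proj Y) i ⟶ line (Spec (.of A)) := hline.lift (f ≫ p) g (by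
    rw [Category.assoc, hfg])
  have hp'map : p' ≫ AffineSpace.map PUnit i = f ≫ p := hline.lift_fst _ _ _
  have hp'proj : p' ≫ line.proj _ = g := hline.lift_snd _ _ _
  have hpb : IsPullback f p' p (AffineSpace.map PUnit i) := by
    refine IsPullback.of_bot ?_ hp'map.symm hline
    rw [hp'proj]
    exact IsPullback.of_hasPullback _ _
  have : Etale p' := MorphismProperty.of_isPullback (P := @Etale) hpb ‹_›
  have : Surjective p' := MorphismProperty.of_isPullback (P := @Surjective) hpb ‹_›
  let σ' : Spec (.of A) ⟶ pullback (p ≫ line.proj Y) i := pullback.lift (i ≫ σ) (𝟙 _) (by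
    rw [Category.assoc, hσ, Category.comp_id, Category.id_comp])
  have hσ'f : σ' ≫ f = i ≫ σ := pullback.lift_fst _ _ _
  have hσ'g : σ' ≫ g = 𝟙 _ := pullback.lift_snd _ _ _
  refine ⟨_, f, inferInstance, ?_, ?_⟩
  · rw [IsOpenImmersion.range_pullbackFst]
    exact hi
  · have := eq_comap_section_of_spec (i ≫ τ) p' σ' (by rw [hp'proj, hσ'g]) (hJ.comap f)
      (fun z hz ↦ by
        have h1 : p' ≫ line.proj _ ≫ i ≫ τ = f ≫ p ≫ line.proj Y ≫ τ := by
          rw [reassoc_of% hp'proj, ← reassoc_of% hfg]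
        rw [h1, Scheme.Hom.comp_apply]
        rw [support_comap] at hz
        exact hsupp _ hz)
      (comap_fst_eq_comap_snd f (AffineSpace.map PUnit i) hp'map hpr)
    rw [this, ← comap_comp _ σ', hσ'f, ← comap_comp, hp'proj, ← comap_comp, ← comap_comp,
      ← reassoc_of% hfg, Category.assoc, Category.assoc]

/-! ### Ghost homotopies in schemes over a local base -/

instance line.smooth_proj (Y : Scheme.{u}) : Smooth (line.proj Y) := by
  have h1 (A : Type u) [CommRing A] : Smooth (line.proj (Spec (.of A))) := by
    have h2 : line.proj (Spec (.of A)) =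
        (line.specIso A).hom ≫ Spec.map (CommRingCat.ofHom Polynomial.C) := by
      rw [← line.specIso_inv_proj, Iso.hom_inv_id_assoc]
    have h3 : Smooth (Spec.map (CommRingCat.ofHom (Polynomial.C : A →+* A[X]))) := by
      rw [HasRingHomProperty.Spec_iff (P := @Smooth)]
      have : Algebra.Smooth A A[X] := ⟨inferInstance, inferInstance⟩
      exact RingHom.smooth_algebraMap.mpr this
    rw [h2]
    infer_instance
  exact MorphismProperty.of_isPullback (P := @Smooth)
    (AffineSpace.isPullback_map (n := PUnit) (specULiftZIsTerminal.from Y)) (h1 _)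

theorem isReduced_of_smooth_over_spec {R : Type u} [CommRing R] [IsDomain R] {Y : Scheme.{u}}
    (τ : Y ⟶ Spec (.of R)) [Smooth τ] : IsReduced Y := by
  have (i : Y.affineCover.I₀) : IsReduced (Y.affineCover.X i) := by
    let j : Spec (.of _) ⟶ Y := Y.affineCover.f i
    have : IsOpenImmersion j := Y.affineCover.map_prop i
    obtain ⟨ψ, hψ⟩ := Spec.map_surjective (j ≫ τ)
    have h1 : Smooth (j ≫ τ) := inferInstance
    rw [← hψ, HasRingHomProperty.Spec_iff (P := @Smooth)] at h1
    have hred : ∀ (A : Type u) [CommRing A] (ψ : R →+* A), ψ.Smooth → IsReduced (Spec (.of A)) := by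
      intro A _ ψ hψ
      algebraize [ψ]
      have := isReduced_of_smooth (R := R) (A := A)
      infer_instance
    exact hred _ ψ.hom h1
  exact IsReduced.of_openCover _ Y.affineCover

theorem IsNisnevichCover.surjective {V Y : Scheme.{u}} {p : V ⟶ Y} (h : IsNisnevichCover p) :
    Surjective p :=
  ⟨fun y ↦ (h.exists_point y).imp fun _ hv ↦ hv.1⟩

theorem apply_eq_apply_zero_of_castSucc_eq_succ {m : ℕ} {T : Type*} {f : Fin (m + 1) → T}
    (h : ∀ i : Fin m, f i.castSucc = f i.succ) (i : Fin (m + 1)) : f i = f 0 := by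
  induction i using Fin.induction with
  | zero => rfl
  | succ i ih => rw [← h, ih]

section

variable {S X : Scheme.{u}} {x : X ⟶ S} {n : ℕ} {U : Scheme.{u}} {s : U ⟶ S} {t₁ t₂ : U ⟶ X}
  (H : GhostStep x (GhostHomotopy x n) U s t₁ t₂)

/-- The inclusion of `V` in the total space. -/
def GhostStep.inl : H.V ⟶ (GhostHomotopy.total (n + 1) H).space := coprod.inl

/-- The inclusion of the total space of a link in the total space. -/
def GhostStep.inr (i : Fin H.chain.length) :
    (GhostHomotopy.total n (H.chain.link i)).space ⟶ (GhostHomotopy.total (n + 1) H).space :=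
  Sigma.ι (fun i ↦ (GhostHomotopy.total n (H.chain.link i)).space) i ≫ coprod.inr

theorem GhostStep.inl_toTarget : H.inl ≫ (GhostHomotopy.total (n + 1) H).toTarget = H.h :=
  coprod.inl_desc _ _

theorem GhostStep.inl_toBase :
    H.inl ≫ (GhostHomotopy.total (n + 1) H).toBase = H.p ≫ line.proj U :=
  coprod.inl_desc _ _

theorem GhostStep.inr_toTarget (i : Fin H.chain.length) :
    H.inr i ≫ (GhostHomotopy.total (n + 1) H).toTarget =
      (GhostHomotopy.total n (H.chain.link i)).toTarget := by
  refine (Category.assoc _ _ _).trans ?_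
  refine (congr_arg (_ ≫ ·) (coprod.inr_desc _ _)).trans ?_
  exact Sigma.ι_desc _ _

theorem GhostStep.inr_toBase (i : Fin H.chain.length) :
    H.inr i ≫ (GhostHomotopy.total (n + 1) H).toBase =
      (GhostHomotopy.total n (H.chain.link i)).toBase ≫ H.q ≫ pullback.fst H.p H.p ≫ H.p ≫
        line.proj U := by
  refine (Category.assoc _ _ _).trans ?_
  refine (congr_arg (_ ≫ ·) (coprod.inr_desc _ _)).trans ?_
  exact Sigma.ι_desc _ _

theorem GhostStep.total_hom_ext {Z : Scheme.{u}}
    {f g : (GhostHomotopy.total (n + 1) H).space ⟶ Z} (h₁ : H.inl ≫ f = H.inl ≫ g)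
    (h₂ : ∀ i, H.inr i ≫ f = H.inr i ≫ g) : f = g :=
  coprod.hom_ext h₁ (Sigma.hom_ext _ _ fun i ↦
    (Category.assoc _ _ _).symm.trans ((h₂ i).trans (Category.assoc _ _ _)))

theorem GhostStep.total_idealSheaf_ext
    {I J : (GhostHomotopy.total (n + 1) H).space.IdealSheafData}
    (h₁ : I.comap H.inl = J.comap H.inl) (h₂ : ∀ i, I.comap (H.inr i) = J.comap (H.inr i)) :
    I = J := by
  refine ext_of_openImmersion fun x ↦ ?_
  let F : Fin H.chain.length → Scheme.{u} :=
    fun i ↦ (GhostHomotopy.total n (H.chain.link i)).space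
  obtain ⟨x | x, rfl⟩ := (coprodMk H.V (∐ F)).surjective x
  · exact ⟨H.V, H.inl, inferInstanceAs (IsOpenImmersion (coprod.inl : H.V ⟶ H.V ⨿ ∐ F)),
      ⟨x, (coprodMk_inl _ _ x).symm⟩, h₁⟩
  · obtain ⟨i, w, rfl⟩ : ∃ (i : Fin H.chain.length) (w : F i), Sigma.ι F i w = x :=
      (sigmaOpenCover F).exists_eq x
    refine ⟨F i, H.inr i, inferInstanceAs (IsOpenImmersion
      (Sigma.ι F i ≫ (coprod.inr : ∐ F ⟶ H.V ⨿ ∐ F))), ⟨w, ?_⟩, h₂ i⟩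
    rw [coprodMk_inr]
    exact Scheme.Hom.comp_apply _ _ _

end

section

variable {R : Type u} [CommRing R] [IsLocalRing R] [IsDomain R] {S X : Scheme.{u}}
  (π : X ⟶ Spec (.of R)) (s : Spec (.of R) ⟶ S)

/-- The part of an `n + 1`-ghost homotopy over `V` lies over the base in the same way as its
starting point. -/
theorem GhostStep.h_comp_eq {Y : Scheme.{u}} {sY : Y ⟶ S} {t₁ t₂ : Y ⟶ X} {n : ℕ}
    (H : GhostStep (π ≫ s) (GhostHomotopy (π ≫ s) n) Y sY t₁ t₂) (τ : Y ⟶ Spec (.of R)) [Smooth τ]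
    (hvert : ∀ i, H.chain.vertex i ≫ π = H.chain.vertex 0 ≫ π) :
    H.h ≫ π = H.p ≫ line.proj Y ≫ t₁ ≫ π := by
  have := H.p_cover.etale
  have := H.p_cover.surjective
  have := H.q_cover.etale
  have := H.q_cover.surjective
  have : Epi H.q := Flat.epi_of_flat_of_surjective H.q
  have : IsReduced Y := isReduced_of_smooth_over_spec τ
  have h1 : pullback.fst H.p H.p ≫ H.h ≫ π = pullback.snd H.p H.p ≫ H.h ≫ π := by
    have := hvert (Fin.last _)
    rw [H.chain.vertex_last, H.chain.vertex_zero] at this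
    simpa [cancel_epi] using this.symm
  -- Since the endpoints of the chain agree over `Spec R`, the map `H.h ≫ π` descends along `H.p` to
  -- the line, where rigidity applies.
  let g : line Y ⟶ Spec (.of R) := EffectiveEpi.desc H.p (H.h ≫ π) fun g₁ g₂ h12 ↦ by
    have h2 := congr_arg (pullback.lift g₁ g₂ h12 ≫ ·) h1
    simpa only [pullback.lift_fst_assoc, pullback.lift_snd_assoc] using h2
  have hg : H.p ≫ g = H.h ≫ π := EffectiveEpi.fac _ _ _
  have h0 : line.zero Y ≫ g = t₁ ≫ π := by
    rw [← H.σ₀_p, Category.assoc, hg, reassoc_of% H.σ₀_h]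
  rw [← hg, line.eq_proj_zero_comp g, h0]

/-- The homotopy is a priori only over `S`; rigidity makes it constant over `Spec R`. The map `τ`
need not be related to `t₁ ≫ π`: it ensures that `Y`, and by induction each `W`, is reduced. -/
theorem GhostHomotopy.comp_eq (n : ℕ) : ∀ {Y : Scheme.{u}} {sY : Y ⟶ S} {t₁ t₂ : Y ⟶ X}
    (H : GhostHomotopy (π ≫ s) n Y sY t₁ t₂) (τ : Y ⟶ Spec (.of R)) [Smooth τ],
    t₁ ≫ π = t₂ ≫ π ∧
      (GhostHomotopy.total n H).toTarget ≫ π = (GhostHomotopy.total n H).toBase ≫ t₁ ≫ π := by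
  induction n with
  | zero =>
    intro Y sY t₁ t₂ (H : LineHomotopy (π ≫ s) Y sY t₁ t₂) τ _
    have : IsReduced Y := isReduced_of_smooth_over_spec τ
    have h1 : H.h ≫ π = line.proj Y ≫ t₁ ≫ π := by
      rw [line.eq_proj_zero_comp (H.h ≫ π), reassoc_of% H.h_zero]
    refine ⟨?_, h1⟩
    rw [← reassoc_of% H.h_one, h1, reassoc_of% line.one_proj]
  | succ n ih =>
    intro Y sY t₁ t₂ (H : GhostStep (π ≫ s) (GhostHomotopy (π ≫ s) n) Y sY t₁ t₂) τ _
    have := H.p_cover.etale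
    have := H.q_cover.etale
    have hl (i : Fin H.chain.length) := ih (H.chain.link i)
      (H.q ≫ pullback.fst H.p H.p ≫ H.p ≫ line.proj Y ≫ τ)
    have hvert := apply_eq_apply_zero_of_castSucc_eq_succ (f := fun i ↦ H.chain.vertex i ≫ π)
      fun i ↦ (hl i).1
    have hh := GhostStep.h_comp_eq π s H τ hvert
    refine ⟨?_, H.total_hom_ext ?_ fun i ↦ ?_⟩
    · rw [← reassoc_of% H.σ₁_h, hh, reassoc_of% H.σ₁_p, reassoc_of% line.one_proj]
    · rw [reassoc_of% H.inl_toTarget, reassoc_of% H.inl_toBase, hh]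
    · have h2 : H.chain.vertex i.castSucc ≫ π = H.chain.vertex 0 ≫ π := hvert i.castSucc
      rw [reassoc_of% H.inr_toTarget, reassoc_of% H.inr_toBase, (hl i).2, h2, H.chain.vertex_zero]
      simp only [Category.assoc, hh]

/-- Induction over all `Y` smooth over `Spec R`, since the links live on `W`. They equate the two
pullbacks of the ideal to `W`, hence to the fibre square by étale descent, so `eq_comap_section`
applies on `V`; restricting to the lift of 1 compares the ends. -/
theorem GhostHomotopy.comap_eq [IsIntegrallyClosed R] (I_T : X.IdealSheafData)
    (hT : ∀ x ∈ I_T.support, ¬ IsGenericPoint (π x) Set.univ) (n : ℕ) :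
    ∀ {Y : Scheme.{u}} {sY : Y ⟶ S} {t₁ t₂ : Y ⟶ X}
      (H : GhostHomotopy (π ≫ s) n Y sY t₁ t₂) [Smooth (t₁ ≫ π)]
      (_ : IsLocallyPrincipal (I_T.comap (GhostHomotopy.total n H).toTarget)),
      I_T.comap t₁ = I_T.comap t₂ ∧
        I_T.comap (GhostHomotopy.total n H).toTarget =
          (I_T.comap t₁).comap (GhostHomotopy.total n H).toBase := by
  have hgen {Y V : Scheme.{u}} {t : Y ⟶ X} {f : V ⟶ X} {g : V ⟶ line Y}
      (hf : f ≫ π = g ≫ line.proj Y ≫ t ≫ π) (v : V) (hv : v ∈ (I_T.comap f).support) :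
      ¬ IsGenericPoint ((g ≫ line.proj Y ≫ t ≫ π) v) Set.univ := by
    rw [← hf, Scheme.Hom.comp_apply]
    rw [support_comap] at hv
    exact hT _ hv
  induction n with
  | zero =>
    intro Y sY t₁ t₂ (H : LineHomotopy (π ≫ s) Y sY t₁ t₂) _
      (hH : IsLocallyPrincipal (I_T.comap H.h))
    have h1 : H.h ≫ π = 𝟙 _ ≫ line.proj Y ≫ t₁ ≫ π := by
      rw [Category.id_comp]
      exact (GhostHomotopy.comp_eq π s 0 H (t₁ ≫ π)).2
    -- The identity serves as cover, so the descent condition is trivial.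
    have h2 := eq_comap_section (t₁ ≫ π) (𝟙 (line Y)) (line.zero Y)
      (by rw [Category.id_comp, line.zero_proj]) hH (hgen h1) (by
        have : pullback.fst (𝟙 (line Y)) (𝟙 (line Y)) = pullback.snd _ _ := by
          simpa using pullback.condition (f := 𝟙 (line Y)) (g := 𝟙 (line Y))
        rw [this])
    rw [← comap_comp _ (line.zero Y), H.h_zero, Category.id_comp] at h2
    refine ⟨?_, h2⟩
    rw [← H.h_one, comap_comp, h2, ← comap_comp, line.one_proj, comap_id]
  | succ n ih =>
    intro Y sY t₁ t₂ (H : GhostStep (π ≫ s) (GhostHomotopy (π ≫ s) n) Y sY t₁ t₂) _ hH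
    have := H.p_cover.etale
    have := H.p_cover.surjective
    have := H.q_cover.etale
    have := H.q_cover.surjective
    have hbase (i : Fin H.chain.length) := GhostHomotopy.comp_eq π s n (H.chain.link i)
      (H.q ≫ pullback.fst H.p H.p ≫ H.p ≫ line.proj Y ≫ t₁ ≫ π)
    have hvert (i) : H.chain.vertex i ≫ π = H.chain.vertex 0 ≫ π :=
      apply_eq_apply_zero_of_castSucc_eq_succ (f := fun i ↦ H.chain.vertex i ≫ π) (fun i ↦ (hbase i).1) i
    have hh := GhostStep.h_comp_eq π s H (t₁ ≫ π) hvert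
    have hl (i : Fin H.chain.length) := by
      -- By rigidity this composite is the structure map of `W` through `Y`, a composite of étale
      -- maps, the projection of the line and `t₁ ≫ π`.
      have : Smooth (H.chain.vertex i.castSucc ≫ π) := by
        rw [hvert, H.chain.vertex_zero, Category.assoc, Category.assoc, hh]
        infer_instance
      refine ih (H.chain.link i) ?_
      rw [← H.inr_toTarget, comap_comp]
      exact hH.comap _
    have hideal (i) : I_T.comap (H.chain.vertex i) = I_T.comap (H.chain.vertex 0) :=
      apply_eq_apply_zero_of_castSucc_eq_succ (f := fun i ↦ I_T.comap (H.chain.vertex i))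
        (fun i ↦ (hl i).1) i
    have hpr : (I_T.comap H.h).comap (pullback.fst H.p H.p) =
        (I_T.comap H.h).comap (pullback.snd H.p H.p) := by
      refine comap_injective_of_etale H.q ?_
      have h1 := hideal (Fin.last _)
      rw [H.chain.vertex_last, H.chain.vertex_zero] at h1
      simp only [comap_comp] at h1
      exact h1.symm
    have hlp : IsLocallyPrincipal (I_T.comap H.h) := by
      rw [← H.inl_toTarget, comap_comp]
      exact hH.comap _
    have h2 := eq_comap_section (t₁ ≫ π) H.p H.σ₀
      (by rw [reassoc_of% H.σ₀_p, line.zero_proj]) hlp (hgen hh) hpr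
    rw [← comap_comp _ H.σ₀, H.σ₀_h] at h2
    refine ⟨?_, H.total_idealSheaf_ext ?_ fun i ↦ ?_⟩
    · rw [← H.σ₁_h, comap_comp, h2, ← comap_comp, reassoc_of% H.σ₁_p, line.one_proj, comap_id]
    · rw [← comap_comp, ← comap_comp, H.inl_toTarget, H.inl_toBase, h2]
    · rw [← comap_comp, ← comap_comp, H.inr_toTarget, H.inr_toBase, (hl i).2, hideal,
        H.chain.vertex_zero]
      simp only [comap_comp, h2]

end

/-! ### Principal ideals on a local scheme and the main theorem -/

/-- An open subset containing the closed point of a local scheme is everything. -/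
theorem IsLocallyPrincipal.exists_eq_idealSheaf_span {R : Type u} [CommRing R] [IsLocalRing R]
    {J : (Spec (.of R)).IdealSheafData} (hJ : IsLocallyPrincipal J) :
    ∃ r : R, J = idealSheaf (Ideal.span {r}) := by
  obtain ⟨U, f, _, hf, a, ha⟩ := hJ (IsLocalRing.closedPoint R)
  have hsub : Set.range (𝟙 (Spec (.of R))) ⊆ Set.range f := fun x _ ↦
    (IsLocalRing.specializes_closedPoint x).mem_open f.isOpenEmbedding.isOpen_range hf
  refine ⟨_, Eq.trans ?_ (sectionIdeal_eq_idealSheaf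
    ((IsOpenImmersion.lift f (𝟙 _) hsub).appTop a))⟩
  rw [← comap_sectionIdeal, ← ha, ← comap_comp, IsOpenImmersion.lift_fac, comap_id]

/-- Transfers local principality from the total space to the pullback of `I_T` along the starting
section. -/
theorem GhostHomotopy.exists_comp_toTarget {S X : Scheme.{u}} {x : X ⟶ S} (n : ℕ)
    {U : Scheme.{u}} {s : U ⟶ S} {t₁ t₂ : U ⟶ X} (H : GhostHomotopy x n U s t₁ t₂) :
    ∃ e : U ⟶ (GhostHomotopy.total n H).space, e ≫ (GhostHomotopy.total n H).toTarget = t₁ := by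
  cases n with
  | zero => exact ⟨line.zero U, LineHomotopy.h_zero H⟩
  | succ n =>
    change GhostStep x (GhostHomotopy x n) U s t₁ t₂ at H
    exact ⟨H.σ₀ ≫ H.inl, by rw [Category.assoc, H.inl_toTarget, H.σ₀_h]⟩

end GhostHomotopyTheory

end

theorem mainTheorem5 {k : Type u} [Field k]
    -- `R` is the henselization of the local ring of a `k`-scheme `Y` at a smooth point `y`
    {Y : Scheme.{u}} (g : Y ⟶ Spec (.of k)) [LocallyOfFinitePresentation g]
    (y : Y) (hy : y ∈ g.smoothLocus)
    (R : Type u) [CommRing R] [Algebra (Y.presheaf.stalk y) R]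
    (hR : GhostHomotopyTheory.IsHenselization (Y.presheaf.stalk y) R)
    -- the structure morphism of `U = Spec R` over `k`
    (s : Spec (.of R) ⟶ Spec (.of k))
    (hs : s = Spec.map (CommRingCat.ofHom (algebraMap (Y.presheaf.stalk y) R)) ≫
      Y.fromSpecStalk y ≫ g)
    -- `X` is of finite type over `U`; no point of `T` lies over the generic point of `U`
    {X : Scheme.{u}} (π : X ⟶ Spec (.of R)) [LocallyOfFiniteType π] [QuasiCompact π]
    (I_T : X.IdealSheafData)
    (hT : ∀ x ∈ I_T.support, ¬ IsGenericPoint (π x) Set.univ)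
    {X' : Scheme.{u}} (b : X' ⟶ X) (hb : GhostHomotopyTheory.IsBlowup b I_T)
    (n : ℕ) (α α' : Spec (.of R) ⟶ X) (hα : α ≫ π = 𝟙 _) (hα' : α' ≫ π = 𝟙 _)
    (H : GhostHomotopyTheory.GhostHomotopy (π ≫ s) n (Spec (.of R)) s α α')
    (hH : H.LiftsAlong b) :
    ∃ r : R,
      (∀ I₀ : Ideal R, (GhostHomotopyTheory.idealSheaf I₀).comap π ≤ I_T → I₀ ≤ Ideal.span {r}) ∧
      I_T.comap α = GhostHomotopyTheory.idealSheaf (Ideal.span {r}) ∧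
      I_T.comap α' = GhostHomotopyTheory.idealSheaf (Ideal.span {r}) ∧
      I_T.comap (GhostHomotopyTheory.GhostHomotopy.total n H).toTarget =
        GhostHomotopyTheory.sectionIdeal (GhostHomotopyTheory.pullbackSection
          (GhostHomotopyTheory.GhostHomotopy.total n H).toBase r) := by
  obtain ⟨_, _⟩ := GhostHomotopyTheory.isDomain_isIntegrallyClosed_stalk g y hy
  obtain ⟨_, _⟩ := hR.isDomain_isIntegrallyClosed
  have := hR.henselian.toIsLocalRing
  have hsm : Smooth (α ≫ π) := by
    rw [hα]
    infer_instance
  have hlp : GhostHomotopyTheory.IsLocallyPrincipal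
      (I_T.comap (GhostHomotopyTheory.GhostHomotopy.total n H).toTarget) := by
    obtain ⟨l, hl⟩ := hH
    rw [← hl, Scheme.IdealSheafData.comap_comp]
    exact hb.isEffectiveCartier.isLocallyPrincipal.comap l
  obtain ⟨hαα', htotal⟩ := H.comap_eq π s I_T hT n hlp
  obtain ⟨e, he⟩ := H.exists_comp_toTarget n
  obtain ⟨r, hr⟩ : ∃ r : R, I_T.comap α = GhostHomotopyTheory.idealSheaf (Ideal.span {r}) := by
    rw [← he, Scheme.IdealSheafData.comap_comp]
    exact (hlp.comap e).exists_eq_idealSheaf_span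
  refine ⟨r, fun I₀ hI₀ ↦ ?_, hr, hαα' ▸ hr, ?_⟩
  · rw [← GhostHomotopyTheory.idealSheaf_mono_iff, ← hr]
    -- Pulling the containment back along the section `α` undoes `π`.
    have h1 := Scheme.IdealSheafData.comap_mono (f := α) hI₀
    dsimp only at h1
    rwa [← Scheme.IdealSheafData.comap_comp, hα, Scheme.IdealSheafData.comap_id] at h1
  · rw [htotal, hr, GhostHomotopyTheory.comap_idealSheaf_span]
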